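/- Setup. Let $c_{00}$ be the space of finitely supported functions $\mathbb N=\{1,2,\dots\}\to\mathbb R$, with unit vectors $e_i$ and biorthogonal functionals $e_i^*$. A finitely supported sequence $a$ also acts on $c_{00}$ by $a(x)=\sum_i a(i)x(i)$. For $I\subseteq\mathbb N$, $Ia$ is $a$ with the coordinates outside $I$ replaced by $0$. For nonzero $a,b\in c_{00}$ write $a<b$ if $\max\operatorname{supp}a<\min\operatorname{supp}b$. Let $f(x)=\log_2(x+1)$. A norm on $c_{00}$ belongs to the class $\mathcal N$ if $(e_i)$ is a normalized monotone Schauder basis of the completion of $(c_{00},\|\cdot\|)$ and $\|e_i^*\|=1$ for all $i$. For $A\subseteq c_{00}$ (regarded as functionals), $\|x\|_A=\sup\{|x^*(x)|:x^*\in A\}$. Let $H\subset c_{00}\cap[-1,1]^{\mathbb N}$ be a countable set of nonzero elements such that: (H$_1$) $H$ is dense in $c_{00}\cap[-1,1]^{\mathbb N}$ for $\|\cdot\|_{\ell_1}$; (H$_2$) if $a\in H$, $I$ is an interval and $Ia\ne0$, then $Ia\in H$; (H$_3$) if $n\ge1$ and $a_1<\dots<a_n$ are in $H$, then $\sum_{i=1}^n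 a_i$, $\frac1{f(n)}\sum_{i=1}^n a_i$ and $\frac1n\sum_{i=1}^n a_i$ are in $H$. Let $M=(M_n)_{n\ge1}\subseteq\mathbb N$ be strictly increasing with $M_1=2$, and let $\sigma$ be an injection from the set of all sequences $(a_1,\dots,a_n)$, $n\ge1$, $a_i\in H$, $a_1<\dots<a_n$, into $\mathbb N$ such that: ($\sigma_1$) if $I$ is an interval and $[j_1,j_2]=\{i\le n:Ia_i\neq0\}\ne\emptyset$, then $\sigma(Ia_{j_1},\dots,Ia_{j_2})\le\sigma(a_1,\dots,a_n)$; ($\sigma_2$) $\max\operatorname{supp}a_n<\sigma(a_1,\dots,a_n)$; ($\sigma_3$) $\sum_{n\in\operatorname{Im}\sigma}\frac1{f(n)}<\infty$; ($\sigma_4$) for $m\in\operatorname{Im}\sigma$ and every integer $\ell\ge1$, the quantity $2\left[\frac{f(m)}m+\frac1{f(\ell)}+\frac{f(m)}m\frac{\min(\ell,m)}{f(\ell)}\right]$ is at most $\frac3{f(\ell)}$ if $\ell$ is at most the predecessor of $m$ in $\operatorname{Im}\sigma$, and at most $\frac{3f(m)}m$ if $\ell$ is at least the successor of $m$ in $\operatorname{Im}\sigma$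 (no condition where the predecessor or successor does not exist). For a family $\mathcal D=(D_i)_{i\ge2}$ of subsets of $H$, a sequence $(x_1^*,\dots,x_n^*)$, $n\ge1$, is $(\mathcal D,M,\sigma)$-admissible if $x_1^*<\dots<x_n^*$, $x_1^*\in\bigcup_{i\ge M_n}D_i$, and $x_{i+1}^*\in D_{\sigma(x_1^*,\dots,x_i^*)}$ for $1\le i<n$. Let $\Gamma_n(\mathcal D,M,\sigma)$ be the set of all $\frac1{f(n)}\sum_{j=1}^n x_j^*$ with $(x_j^*)_1^n$ $(\mathcal D,M,\sigma)$-admissible. For $\|\cdot\|\in\mathcal N$ and $X=(c_{00},\|\cdot\|)$, with $B(X^*)$ the closed unit ball of the dual $X^*$, put for $m\ge2$ $$A_m^X=\Bigl\{\tfrac1m\sum_{i=1}^m a_i^*: a_i^*\in H\cap B(X^*),\ a_1^*<\dots<a_m^*\Bigr\},\qquad \tilde A_m^X=\bigcup_{n\ge m}A_n^X,\qquad B_m^X=\Gamma_m\bigl((\tilde A_i^X)_{i\ge2},M,\sigma\bigr),$$ and $C^X=\bigcup_{n\ge1}C_n^X$ with $C_n^X=\Gamma_n\bigl((B_i^X)_{i\ge2},M,\sigma\bigr)$.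 Proposition 3.1. For all $H,M,\sigma$ as above there exists a norm $\|\cdot\|\in\mathcal N$ such that, with $X=(c_{00},\|\cdot\|)$, $$\|x\|=\max\bigl(\|x\|_\infty,\|x\|_{C^X}\bigr)\qquad\text{for all }x\in c_{00},$$ the supremum defining $\|x\|_{C^X}$ being finite. Moreover the completion of $X$ is reflexive, and its basis $(e_i)$ is shrinking (for every functional $\varphi$, the norm of $\varphi$ restricted to the closed span of $(e_i)_{i\ge n}$ tends to $0$) and boundedly complete (if the partial sums of $\sum a_ie_i$ are bounded, the series converges). -/

import Mathlib

namespace OdellSchlumprecht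

/-- The space of finitely supported real sequences. The coordinate `i : ℕ` stands for the
`(i + 1)`-st coordinate when sequences are indexed by the positive integers. -/
abbrev C00 : Type := ℕ →₀ ℝ

/-- The unit vectors of `C00`. -/
noncomputable def unitVec (i : ℕ) : C00 := Finsupp.single i 1

/-- A finitely supported sequence `a`, regarded as the functional `∑ aᵢ eᵢ*`, applied to `x`. -/
noncomputable def pair (a x : C00) : ℝ := a.sum fun i r => r * x i

/-- The restriction `I a`: coordinates outside `I` are replaced by zero. -/
noncomputable def restrict (I : Set ℕ) (a : C00) : C00 :=
  by classical exact a.filter (fun i => i ∈ I)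

/-- `a < b`: the support of `a` lies to the left of the support of `b`. -/
def Precedes (a b : C00) : Prop := ∀ i ∈ a.support, ∀ j ∈ b.support, i < j

/-- `l = [a₁, …, aₙ]` consists of nonzero elements with `a₁ < ⋯ < aₙ`. -/
def IsBlock (l : List C00) : Prop := (∀ a ∈ l, a ≠ 0) ∧ l.Pairwise Precedes

/-- The nonempty finite block sequences in `H`: the domain of the coding function. -/
def blocksIn (H : Set C00) : Set (List C00) := {l | l ≠ [] ∧ IsBlock l ∧ ∀ a ∈ l, a ∈ H}

/-- `f(x) = log₂(x + 1)`. -/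
noncomputable def f (x : ℝ) : ℝ := Real.logb 2 (x + 1)

/-! ### The class of norms and the associated spaces -/

/-- `C00` with a given (semi)norm. -/
def Space (_N : Seminorm ℝ C00) : Type := C00

noncomputable instance (N : Seminorm ℝ C00) : SeminormedAddCommGroup (Space N) :=
  N.toAddGroupSeminorm.toSeminormedAddCommGroup

noncomputable instance (N : Seminorm ℝ C00) : NormedSpace ℝ (Space N) where
  toModule := inferInstanceAs (Module ℝ C00)
  norm_smul_le r x := (map_smul_eq_mul N r x).le

/-- The Banach space obtained by completing `C00` with respect to `N`. -/
abbrev CompletionOf (N : Seminorm ℝ C00) : Type := UniformSpace.Completion (Space N)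

/-- An element of `C00`, seen in the completion. -/
noncomputable def toCompl (N : Seminorm ℝ C00) (x : C00) : CompletionOf N :=
  ((show Space N from x) : UniformSpace.Completion (Space N))

/-- The norms on `C00` for which `(eᵢ)` is a normalized monotone Schauder basis of the
completion with biorthogonal functionals of norm one. -/
def ClassN (N : Seminorm ℝ C00) : Prop :=
  (∀ x, N x = 0 → x = 0) ∧
  ∃ b : SchauderBasis ℝ (CompletionOf N),
    (∀ i, b i = toCompl N (unitVec i)) ∧
    (∀ i, ‖b i‖ = 1) ∧
    (∀ n, ‖b.proj n‖ ≤ 1) ∧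
    (∀ i, ‖b.coord i‖ = 1)

/-- The finitely supported elements of the dual unit ball `B(X*)` of `X = (C00, N)`. -/
def dualBall (N : Seminorm ℝ C00) : Set C00 := {a | ∀ x, |pair a x| ≤ N x}

/-- `‖x‖_∞`. -/
noncomputable def supNorm (x : C00) : ℝ := ⨆ i, |x i|

/-- The set `{|x*(x)| : x* ∈ A}`. -/
def absValues (A : Set C00) (x : C00) : Set ℝ := (fun a => |pair a x|) '' A

/-! ### The data `H`, `M`, `σ` -/

/-- The properties required of the set `H` of finitely supported sequences. -/
structure IsBaseSet (H : Set C00) : Prop where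
  countable : H.Countable
  ne_zero : ∀ a ∈ H, a ≠ 0
  abs_le_one : ∀ a ∈ H, ∀ i, |a i| ≤ 1
  /-- `H` is dense, for the `ℓ₁` norm, in the set of finitely supported sequences with
  coordinates in `[-1, 1]`. -/
  dense : ∀ x : C00, (∀ i, |x i| ≤ 1) → ∀ ε : ℝ, 0 < ε →
    ∃ a ∈ H, ((x - a).sum fun _ r => |r|) < ε
  restrict_mem : ∀ a ∈ H, ∀ I : Set ℕ, I.OrdConnected → restrict I a ≠ 0 → restrict I a ∈ H
  sum_mem : ∀ l ∈ blocksIn H, l.sum ∈ H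
  div_f_mem : ∀ l ∈ blocksIn H, (1 / f l.length) • l.sum ∈ H
  average_mem : ∀ l ∈ blocksIn H, (1 / (l.length : ℝ)) • l.sum ∈ H

/-- The restrictions of the members of `l` to `I`, those that vanish being left out. -/
noncomputable def restrictList (I : Set ℕ) (l : List C00) : List C00 :=
  by classical exact (l.map (restrict I)).filter (fun a => a ≠ 0)

/-- The expression in square brackets of the growth condition on the range of the coding. -/
noncomputable def gapExpr (m l : ℕ) : ℝ :=
  f m / m + 1 / f l + f m / m * ((min l m : ℕ) / f l)

/-- The properties required of the coding function `σ` (only its values on the nonempty block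
sequences in `H` matter; `σ '' blocksIn H` is its range). -/
structure IsCoding (H : Set C00) (σ : List C00 → ℕ) : Prop where
  injOn : Set.InjOn σ (blocksIn H)
  restrict_le : ∀ l ∈ blocksIn H, ∀ I : Set ℕ, I.OrdConnected → restrictList I l ≠ [] →
    σ (restrictList I l) ≤ σ l
  /-- The code exceeds the maximum of the support (counted from `1`) of the last member. -/
  supp_lt : ∀ l ∈ blocksIn H, ∀ a ∈ l.getLast?, ∀ i ∈ a.support, i + 1 < σ l
  summable : Summable fun n : (σ '' blocksIn H : Set ℕ) => 1 / f ((n : ℕ) : ℝ)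
  /-- `l` is at most the predecessor of `m` in the range of `σ`. -/
  gap_below : ∀ m ∈ σ '' blocksIn H, ∀ l : ℕ, 1 ≤ l →
    (∃ m' ∈ σ '' blocksIn H, m' < m ∧ l ≤ m') → 2 * gapExpr m l ≤ 3 / f l
  /-- `l` is at least the successor of `m` in the range of `σ`. -/
  gap_above : ∀ m ∈ σ '' blocksIn H, ∀ l : ℕ, 1 ≤ l →
    (∃ m' ∈ σ '' blocksIn H, m < m' ∧ m' ≤ l) → 2 * gapExpr m l ≤ 3 * f m / m

/-- The properties required of `M = (M₁, M₂, …)`; the value `M 0` plays no role. -/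
def IsIndexSeq (M : ℕ → ℕ) : Prop := StrictMonoOn M (Set.Ici 1) ∧ M 1 = 2

/-! ### Admissible sequences and the three layers -/

/-- `(x₁, …, xₙ)`, `n ≥ 1`, is `(D, M, σ)`-admissible: `x₁ < ⋯ < xₙ`, `x₁ ∈ ⋃_{i ≥ M n} D i`, and
`x_{i+1} ∈ D (σ (x₁, …, xᵢ))` for `1 ≤ i < n`. -/
def IsAdmissible (D : ℕ → Set C00) (M : ℕ → ℕ) (σ : List C00 → ℕ) (l : List C00) : Prop :=
  IsBlock l ∧
  (∃ h : 0 < l.length, ∃ i, M l.length ≤ i ∧ l[0] ∈ D i) ∧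
  ∀ i, 1 ≤ i → ∀ h : i < l.length, l[i] ∈ D (σ (l.take i))

/-- `Γ_n(D, M, σ)`. -/
def Gam (D : ℕ → Set C00) (M : ℕ → ℕ) (σ : List C00 → ℕ) (n : ℕ) : Set C00 :=
  {a | ∃ l : List C00, IsAdmissible D M σ l ∧ l.length = n ∧ a = (1 / f n) • l.sum}

/-- `A_m`: averages of `m` successive members of `H ∩ B(X*)` (used for `m ≥ 2`). -/
def setA (H : Set C00) (N : Seminorm ℝ C00) (m : ℕ) : Set C00 :=
  {a | ∃ l : List C00, IsBlock l ∧ (∀ b ∈ l, b ∈ H ∩ dualBall N) ∧ l.length = m ∧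
    a = (1 / (m : ℝ)) • l.sum}

/-- `Ã_m = ⋃_{n ≥ m} A_n` (used for `m ≥ 2`). -/
def setAt (H : Set C00) (N : Seminorm ℝ C00) (m : ℕ) : Set C00 :=
  {a | ∃ n, 2 ≤ n ∧ m ≤ n ∧ a ∈ setA H N n}

/-- `B_m = Γ_m(Ã, M, σ)`, `m ≥ 2`. The family is left empty for `m < 2`. -/
def setB (H : Set C00) (M : ℕ → ℕ) (σ : List C00 → ℕ) (N : Seminorm ℝ C00) (m : ℕ) : Set C00 :=
  {a | 2 ≤ m ∧ a ∈ Gam (setAt H N) M σ m}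

/-- `C = ⋃_{n ≥ 1} C_n`, where `C_n = Γ_n(B, M, σ)`. -/
def setC (H : Set C00) (M : ℕ → ℕ) (σ : List C00 → ℕ) (N : Seminorm ℝ C00) : Set C00 :=
  {a | ∃ n, 1 ≤ n ∧ a ∈ Gam (setB H M σ N) M σ n}

/-! ### Reflexivity, shrinking and boundedly complete sequences -/

/-- The canonical embedding into the bidual is onto. -/
def IsReflexive (E : Type*) [NormedAddCommGroup E] [NormedSpace ℝ E] : Prop :=
  Function.Surjective (NormedSpace.inclusionInDoubleDual ℝ E)

/-- For every functional, the norm of its restriction to the closed span of the tail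
`(eᵢ)_{i ≥ n}` tends to `0`. -/
def IsShrinking {E : Type*} [NormedAddCommGroup E] [NormedSpace ℝ E] (e : ℕ → E) : Prop :=
  ∀ φ : StrongDual ℝ E, ∀ ε : ℝ, 0 < ε → ∃ n : ℕ,
    ∀ x ∈ (Submodule.span ℝ (e '' Set.Ici n)).topologicalClosure, |φ x| ≤ ε * ‖x‖

/-- If the partial sums of `∑ aᵢ eᵢ` are bounded, then the series converges. -/
def IsBoundedlyComplete {E : Type*} [NormedAddCommGroup E] [NormedSpace ℝ E] (e : ℕ → E) : Prop :=
  ∀ a : ℕ → ℝ, (∃ K : ℝ, ∀ n, ‖∑ i ∈ Finset.range n, a i • e i‖ ≤ K) →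
    ∃ x : E, Filter.Tendsto (fun n => ∑ i ∈ Finset.range n, a i • e i) Filter.atTop (nhds x)

end OdellSchlumprecht

namespace OdellSchlumprecht

/-! ### The duality pairing -/

/-! The set `setC` is built from the dual ball of the norm it is meant to define, so the norm is a
fixed point. The unknown is taken to be a set `W` of functionals in place of the dual ball.
Enlarging `W` enlarges the three layers, hence the norm they give, hence its dual ball, so
Knaster–Tarski applies (`exists_isSolution`). The solution must also have contractive initial
projections. Truncating an admissible sequence would shorten it and change its weight. Instead the
sequence is kept at full length, cut at `n`, and everything after the cut is chosen anew beyond the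
support of the vector being tested (`Adm.prolong`, `functionalNorm_restrict_Iio_le`).

For shrinking, suppose a bounded functional `ψ` takes a value `t > 0` at vectors of norm at most one
arbitrarily far out. Such vectors can be replaced by averages with the same value of `ψ` but norm at
most `7/8` (`exists_norm_le`); rescaling and iterating makes `ψ` unbounded (`not_spread`). The gain
comes from the first layer, where at least two functionals are averaged: two block sequences of
lengths `n` and `L` have at most `n + L` meeting pairs (`sum_length_meeting_le`), so a first-layer
functional costs about `L / 2` on a sum of `L` blocks. The other two layers are handled by gliding
humps (`exists_average_of_small_index`): small indices obey the block estimate, large indices are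
negligible because coordinates are at most `1 / f m`, and each functional has intermediate index for
at most one hump.

For bounded completeness, a bounded but divergent series has infinitely many blocks of norm at least
`ε`. Functionals in `H` detecting them can be averaged and then combined according to the coding,
giving second-layer functionals of value at least `m / f m` times a constant
(`exists_mem_setB_le_apply`). These lie in the dual ball, and `m / f m` is unbounded, a
contradiction.

Reflexivity then follows from James' classical argument for shrinking, boundedly complete bases. -/

lemma pair_eq_sum_left {a x : C00} {s : Finset ℕ} (h : a.support ⊆ s) :
    pair a x = ∑ i ∈ s, a i * x i :=
  Finsupp.sum_of_support_subset _ h _ (by simp)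

lemma pair_eq_sum_right {a x : C00} {s : Finset ℕ} (h : x.support ⊆ s) :
    pair a x = ∑ i ∈ s, a i * x i := by
  rw [pair_eq_sum_left (Finset.subset_union_left (s₂ := s))]
  refine (Finset.sum_subset Finset.subset_union_right fun i _ hi => ?_).symm
  have : x i = 0 := by
    by_contra h'
    exact hi (h (Finsupp.mem_support_iff.2 h'))
  simp [this]

@[simp] lemma pair_zero_left (x : C00) : pair 0 x = 0 := by simp [pair]

@[simp] lemma pair_zero_right (a : C00) : pair a 0 = 0 := by simp [pair]

lemma pair_add_left (a b x : C00) : pair (a + b) x = pair a x + pair b x :=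
  Finsupp.sum_add_index' (by simp) (by intros; ring)

lemma pair_smul_left (r : ℝ) (a x : C00) : pair (r • a) x = r * pair a x := by
  rw [pair_eq_sum_left Finsupp.support_smul, pair_eq_sum_left subset_rfl, Finset.mul_sum]
  exact Finset.sum_congr rfl fun i _ => by simp [mul_assoc]

lemma pair_add_right (a x y : C00) : pair a (x + y) = pair a x + pair a y := by
  simp only [pair_eq_sum_left (subset_refl a.support), ← Finset.sum_add_distrib]
  exact Finset.sum_congr rfl fun i _ => by simp [mul_add]

lemma pair_smul_right (r : ℝ) (a x : C00) : pair a (r • x) = r * pair a x := by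
  simp only [pair_eq_sum_left (subset_refl a.support), Finset.mul_sum]
  exact Finset.sum_congr rfl fun i _ => by simp only [Finsupp.smul_apply, smul_eq_mul]; ring

lemma pair_neg_left (a x : C00) : pair (-a) x = -pair a x := by
  simpa using pair_smul_left (-1) a x

lemma pair_sub_left (a b x : C00) : pair (a - b) x = pair a x - pair b x := by
  rw [sub_eq_add_neg, pair_add_left, pair_neg_left, sub_eq_add_neg]

lemma pair_single_left (i : ℕ) (r : ℝ) (x : C00) : pair (Finsupp.single i r) x = r * x i := by
  simp [pair]

lemma pair_unitVec_right (a : C00) (i : ℕ) : pair a (unitVec i) = a i := by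
  rw [unitVec, pair_eq_sum_right (s := {i}) Finsupp.support_single_subset]
  simp

lemma pair_list_sum_left (l : List C00) (x : C00) :
    pair l.sum x = (l.map fun a => pair a x).sum := by
  induction l with
  | nil => simp
  | cons a l ih => simp [pair_add_left, ih]

lemma pair_list_sum_right (a : C00) (l : List C00) :
    pair a l.sum = (l.map fun x => pair a x).sum := by
  induction l with
  | nil => simp
  | cons x l ih => simp [pair_add_right, ih]

lemma pair_eq_zero {a x : C00} (h : ∀ i ∈ a.support, i ∉ x.support) : pair a x = 0 := by
  rw [pair_eq_sum_left subset_rfl]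
  refine Finset.sum_eq_zero fun i hi => ?_
  have := h i hi
  simp only [Finsupp.mem_support_iff, not_not] at this
  simp [this]

lemma pair_congr_left {a b x : C00} (h : ∀ i ∈ x.support, a i = b i) : pair a x = pair b x := by
  rw [pair_eq_sum_right subset_rfl, pair_eq_sum_right subset_rfl]
  exact Finset.sum_congr rfl fun i hi => by rw [h i hi]

/-- The `ℓ₁` norm. -/
noncomputable def oneNorm (x : C00) : ℝ := x.sum fun _ r => |r|

lemma oneNorm_eq_sum (x : C00) : oneNorm x = ∑ i ∈ x.support, |x i| := rfl

lemma oneNorm_nonneg (x : C00) : 0 ≤ oneNorm x := Finset.sum_nonneg fun _ _ => abs_nonneg _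

lemma abs_apply_le_oneNorm (x : C00) (i : ℕ) : |x i| ≤ oneNorm x := by
  by_cases h : i ∈ x.support
  · exact Finset.single_le_sum (f := fun i => |x i|) (fun _ _ => abs_nonneg _) h
  · rw [Finsupp.notMem_support_iff.1 h]
    simpa using oneNorm_nonneg x

lemma abs_pair_le_mul_oneNorm_right {a x : C00} {t : ℝ} (h : ∀ i, |a i| ≤ t) :
    |pair a x| ≤ t * oneNorm x := by
  rw [pair_eq_sum_right subset_rfl, oneNorm_eq_sum, Finset.mul_sum]
  refine (Finset.abs_sum_le_sum_abs _ _).trans (Finset.sum_le_sum fun i _ => ?_)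
  rw [abs_mul]
  exact mul_le_mul_of_nonneg_right (h i) (abs_nonneg _)

lemma abs_pair_le_mul_oneNorm_left {a x : C00} {t : ℝ} (h : ∀ i, |x i| ≤ t) :
    |pair a x| ≤ t * oneNorm a := by
  rw [pair_eq_sum_left subset_rfl, oneNorm_eq_sum, Finset.mul_sum]
  refine (Finset.abs_sum_le_sum_abs _ _).trans (Finset.sum_le_sum fun i _ => ?_)
  rw [abs_mul, mul_comm]
  exact mul_le_mul_of_nonneg_right (h i) (abs_nonneg _)

/-! ### Restrictions -/

lemma restrict_apply_of_mem {I : Set ℕ} {i : ℕ} (h : i ∈ I) (a : C00) : restrict I a i = a i := by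
  classical
  rw [restrict, Finsupp.filter_apply_pos _ _ h]

lemma restrict_apply_of_notMem {I : Set ℕ} {i : ℕ} (h : i ∉ I) (a : C00) :
    restrict I a i = 0 := by
  classical
  rw [restrict, Finsupp.filter_apply_neg _ _ h]

lemma abs_restrict_apply_le (I : Set ℕ) (a : C00) (i : ℕ) : |restrict I a i| ≤ |a i| := by
  by_cases h : i ∈ I
  · rw [restrict_apply_of_mem h]
  · simp [restrict_apply_of_notMem h]

lemma pair_restrict (I : Set ℕ) (a x : C00) : pair (restrict I a) x = pair a (restrict I x) := by
  have h : ∀ i, restrict I a i * x i = a i * restrict I x i := fun i => by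
    by_cases h : i ∈ I
    · rw [restrict_apply_of_mem h, restrict_apply_of_mem h]
    · simp [restrict_apply_of_notMem h]
  rw [pair_eq_sum_left (s := a.support), pair_eq_sum_left subset_rfl]
  · exact Finset.sum_congr rfl fun i _ => h i
  · intro i hi
    rw [Finsupp.mem_support_iff] at hi ⊢
    intro h0
    exact hi (abs_nonpos_iff.1 ((abs_restrict_apply_le I a i).trans (by simp [h0])))

lemma restrict_restrict (I J : Set ℕ) (a : C00) :
    restrict I (restrict J a) = restrict (I ∩ J) a := by
  ext i
  by_cases h : i ∈ I <;> by_cases h' : i ∈ J <;>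
    simp [restrict_apply_of_mem, restrict_apply_of_notMem, h, h']

lemma restrict_eq_self {I : Set ℕ} {a : C00} (h : ∀ i ∈ a.support, i ∈ I) : restrict I a = a := by
  ext i
  by_cases hi : i ∈ I
  · rw [restrict_apply_of_mem hi]
  · rw [restrict_apply_of_notMem hi]
    by_contra h'
    exact hi (h i (Finsupp.mem_support_iff.2 (Ne.symm h')))

lemma restrict_add (I : Set ℕ) (a b : C00) : restrict I (a + b) = restrict I a + restrict I b := by
  ext i
  by_cases h : i ∈ I <;> simp [restrict_apply_of_mem, restrict_apply_of_notMem, h]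

lemma restrict_smul (I : Set ℕ) (r : ℝ) (a : C00) : restrict I (r • a) = r • restrict I a := by
  ext i
  by_cases h : i ∈ I <;> simp [restrict_apply_of_mem, restrict_apply_of_notMem, h]

lemma exists_support_lt (x : C00) : ∃ n, ∀ i ∈ x.support, i < n := by
  obtain ⟨n, hn⟩ := x.support.exists_nat_subset_range
  exact ⟨n, fun i hi => Finset.mem_range.1 (hn hi)⟩

lemma exists_restrict_Iio_eq (a : C00) : ∃ n, restrict (Set.Iio n) a = a := by
  obtain ⟨n, hn⟩ := exists_support_lt a
  exact ⟨n, restrict_eq_self hn⟩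

/-! ### The supremum norm -/

lemma bddAbove_abs (x : C00) : BddAbove (Set.range fun i => |x i|) :=
  ⟨oneNorm x, by rintro _ ⟨i, rfl⟩; exact abs_apply_le_oneNorm x i⟩

lemma abs_apply_le_supNorm (x : C00) (i : ℕ) : |x i| ≤ supNorm x := le_ciSup (bddAbove_abs x) i

lemma supNorm_le {x : C00} {t : ℝ} (h : ∀ i, |x i| ≤ t) : supNorm x ≤ t := ciSup_le h

lemma supNorm_nonneg (x : C00) : 0 ≤ supNorm x := (abs_nonneg _).trans (abs_apply_le_supNorm x 0)

/-! ### The function `f` -/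

lemma one_le_f {n : ℕ} (h : 1 ≤ n) : 1 ≤ f n := by
  rw [f, Real.le_logb_iff_rpow_le (by norm_num) (by positivity)]
  have : (1 : ℝ) ≤ n := by exact_mod_cast h
  norm_num
  linarith

lemma f_pos {n : ℕ} (h : 1 ≤ n) : 0 < f n := one_pos.trans_le (one_le_f h)

lemma f_one : f 1 = 1 := by
  rw [f]
  norm_num

lemma one_div_f_le_one {n : ℕ} (h : 1 ≤ n) : 1 / f n ≤ 1 := by
  rw [div_le_one (f_pos h)]
  exact one_le_f h

lemma tendsto_f : Filter.Tendsto (fun n : ℕ => f n) Filter.atTop Filter.atTop :=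
  (Real.tendsto_logb_atTop (by norm_num)).comp
    (Filter.tendsto_atTop_add_const_right _ 1 tendsto_natCast_atTop_atTop)

/-- Along `n = 2 ^ k` the denominator is at most `k + 1`, and an exponential outgrows a linear
function. -/
lemma exists_lt_div_f (K : ℝ) : ∃ n : ℕ, 2 ≤ n ∧ K < n / f n := by
  obtain ⟨k, hk⟩ : ∃ k : ℕ, 1 ≤ k ∧ K * (k + 1) < 2 ^ k := by
    have h1 : Filter.Tendsto (fun k : ℕ => (K * (k : ℝ) ^ 1 + K) / 2 ^ k) Filter.atTop
        (nhds 0) := by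
      have ha := (tendsto_pow_const_div_const_pow_of_one_lt 1 (r := (2 : ℝ))
        (by norm_num)).const_mul K
      have hb := (tendsto_pow_const_div_const_pow_of_one_lt 0 (r := (2 : ℝ))
        (by norm_num)).const_mul K
      simpa [add_mul, mul_assoc, div_eq_mul_inv] using ha.add hb
    obtain ⟨k, hk, hk'⟩ := ((h1.eventually (gt_mem_nhds one_pos)).and
      (Filter.eventually_ge_atTop 1)).exists
    refine ⟨k, hk', ?_⟩
    rw [div_lt_one (by positivity)] at hk
    linarith
  refine ⟨2 ^ k, ?_, ?_⟩
  · calc 2 = 2 ^ 1 := rfl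
      _ ≤ 2 ^ k := Nat.pow_le_pow_right (by norm_num) hk.1
  · have hp : 1 ≤ 2 ^ k := Nat.one_le_two_pow
    rw [lt_div_iff₀ (f_pos hp)]
    have hf : f (2 ^ k : ℕ) ≤ k + 1 := by
      rw [f, Real.logb_le_iff_le_rpow (by norm_num) (by positivity)]
      have : (1 : ℝ) ≤ 2 ^ k := by exact_mod_cast hp
      push_cast
      rw [Real.rpow_add (by norm_num), Real.rpow_natCast]
      norm_num
      linarith
    rcases le_or_gt K 0 with h | h
    · have := f_pos hp
      have h2 : (0 : ℝ) < (2 ^ k : ℕ) := by positivity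
      nlinarith [mul_nonneg_of_nonpos_of_nonpos h (neg_nonpos.2 this.le)]
    · push_cast at hf ⊢
      nlinarith [hk.2]

/-! ### Block sequences -/

lemma list_sum_apply (l : List C00) (i : ℕ) : l.sum i = (l.map fun a => a i).sum := by
  induction l with
  | nil => simp
  | cons a l ih => simp [ih]

lemma exists_mem_support_of_mem_support_sum {l : List C00} {i : ℕ} (h : i ∈ l.sum.support) :
    ∃ a ∈ l, i ∈ a.support := by
  by_contra! h'
  refine (Finsupp.mem_support_iff.1 h) ?_
  rw [list_sum_apply]
  refine List.sum_eq_zero fun r hr => ?_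
  obtain ⟨a, ha, rfl⟩ := List.mem_map.1 hr
  simpa using h' a ha

lemma sum_apply_eq_zero {l : List C00} {i : ℕ} (h : ∀ a ∈ l, i ∉ a.support) : l.sum i = 0 := by
  by_contra h'
  obtain ⟨a, ha, hi⟩ := exists_mem_support_of_mem_support_sum (Finsupp.mem_support_iff.2 h')
  exact h a ha hi

lemma abs_sum_apply_le {l : List C00} (hl : l.Pairwise Precedes) {t : ℝ} (ht : 0 ≤ t)
    (h : ∀ a ∈ l, ∀ i, |a i| ≤ t) (i : ℕ) : |l.sum i| ≤ t := by
  induction l with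
  | nil => simpa
  | cons a l ih =>
    rw [List.pairwise_cons] at hl
    rw [List.sum_cons, Finsupp.add_apply]
    by_cases hi : i ∈ a.support
    · rw [sum_apply_eq_zero fun b hb hib => lt_irrefl i (hl.1 b hb i hi i hib), add_zero]
      exact h a (by simp) i
    · rw [Finsupp.notMem_support_iff.1 hi, zero_add]
      exact ih hl.2 fun b hb => h b (by simp [hb])

lemma precedes_of_support_lt {a b : C00} {n : ℕ} (ha : ∀ i ∈ a.support, i < n)
    (hb : ∀ i ∈ b.support, n ≤ i) : Precedes a b := fun i hi j hj => (ha i hi).trans_le (hb j hj)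

lemma exists_support_lt_list (l : List C00) : ∃ n, ∀ a ∈ l, ∀ i ∈ a.support, i < n := by
  induction l with
  | nil => exact ⟨0, by simp⟩
  | cons a l ih =>
    obtain ⟨n, hn⟩ := ih
    obtain ⟨m, hm⟩ := exists_support_lt a
    refine ⟨max n m, fun b hb i hi => ?_⟩
    rcases List.mem_cons.1 hb with rfl | hb
    · exact lt_max_of_lt_right (hm i hi)
    · exact lt_max_of_lt_left (hn b hb i hi)

lemma isBlock_append_singleton {l : List C00} {x : C00} :
    IsBlock (l ++ [x]) ↔ IsBlock l ∧ x ≠ 0 ∧ ∀ a ∈ l, Precedes a x := by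
  simp only [IsBlock, List.mem_append, List.mem_singleton, List.pairwise_append,
    List.pairwise_cons, List.not_mem_nil, List.Pairwise.nil]
  grind

/-! ### Admissible sequences, one member at a time -/

/-- The members that may follow `l` in an admissible sequence whose first member lies in
`⋃_{i ≥ K} D i`. -/
def nextSet (D : ℕ → Set C00) (σ : List C00 → ℕ) (K : ℕ) (l : List C00) : Set C00 :=
  {x | (l = [] ∧ ∃ i, K ≤ i ∧ x ∈ D i) ∨ (l ≠ [] ∧ x ∈ D (σ l))}

/-- Block sequences whose first member lies in `⋃_{i ≥ K} D i` and whose later members are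
prescribed by the coding. -/
inductive Adm (D : ℕ → Set C00) (σ : List C00 → ℕ) (K : ℕ) : List C00 → Prop
  | nil : Adm D σ K []
  | snoc {l : List C00} {x : C00} : Adm D σ K l → x ≠ 0 → (∀ a ∈ l, Precedes a x) →
      x ∈ nextSet D σ K l → Adm D σ K (l ++ [x])

section Adm

variable {D : ℕ → Set C00} {σ : List C00 → ℕ} {K : ℕ} {M : ℕ → ℕ}

lemma adm_append_singleton {l : List C00} {x : C00} :
    Adm D σ K (l ++ [x]) ↔
      Adm D σ K l ∧ x ≠ 0 ∧ (∀ a ∈ l, Precedes a x) ∧ x ∈ nextSet D σ K l := by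
  refine ⟨fun h => ?_, fun h => .snoc h.1 h.2.1 h.2.2.1 h.2.2.2⟩
  generalize hl : l ++ [x] = l' at h
  cases h with
  | nil => simp at hl
  | snoc h1 h2 h3 h4 =>
    obtain ⟨rfl, hx⟩ := List.append_inj' hl rfl
    obtain rfl := List.singleton_inj.1 hx
    exact ⟨h1, h2, h3, h4⟩

lemma adm_iff {l : List C00} : Adm D σ K l ↔ IsBlock l ∧
    (∀ h : 0 < l.length, ∃ i, K ≤ i ∧ l[0] ∈ D i) ∧
    ∀ i, 1 ≤ i → ∀ h : i < l.length, l[i] ∈ D (σ (l.take i)) := by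
  induction l using List.reverseRecOn with
  | nil => simp [Adm.nil, IsBlock]
  | append_singleton l x ih =>
    rw [adm_append_singleton, ih, isBlock_append_singleton]
    rcases eq_or_ne l [] with rfl | hl
    · simp [nextSet, IsBlock]
      intro _ _ _ _ _ h
      omega
    · have hl' : 0 < l.length := List.length_pos_iff.2 hl
      constructor
      · rintro ⟨⟨h1, h2, h3⟩, h4, h5, h6⟩
        refine ⟨⟨h1, h4, h5⟩, fun _ => ?_, fun i hi h => ?_⟩
        · rw [List.getElem_append_left hl']
          exact h2 hl'
        · rcases (Nat.lt_or_ge i l.length) with h' | h'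
          · rw [List.getElem_append_left h', List.take_append_of_le_length h'.le]
            exact h3 i hi h'
          · have : i = l.length := by simp at h; omega
            subst this
            simpa [nextSet, hl] using h6
      · rintro ⟨⟨h1, h4, h5⟩, h2, h3⟩
        refine ⟨⟨h1, fun _ => ?_, fun i hi h => ?_⟩, h4, h5, ?_⟩
        · have := h2 (by simp)
          rwa [List.getElem_append_left hl'] at this
        · have := h3 i hi (by simp; omega)
          rwa [List.getElem_append_left h, List.take_append_of_le_length h.le] at this
        · have := h3 l.length hl' (by simp)
          simpa [nextSet, hl] using this

/-- The threshold `M l.length` depends on the final length, so an initial segment of an admissible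
sequence need not be admissible. Freezing the threshold as `K` makes the notion hereditary and
permits induction. -/
lemma isAdmissible_iff {l : List C00} :
    IsAdmissible D M σ l ↔ l ≠ [] ∧ Adm D σ (M l.length) l := by
  rw [adm_iff, IsAdmissible, ← List.length_pos_iff]
  constructor
  · rintro ⟨h1, ⟨h2, h3⟩, h4⟩
    exact ⟨h2, h1, fun _ => h3, h4⟩
  · rintro ⟨h2, h1, h3, h4⟩
    exact ⟨h1, ⟨h2, h3 h2⟩, h4⟩

lemma Adm.isBlock {l : List C00} (h : Adm D σ K l) : IsBlock l := (adm_iff.1 h).1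

lemma Adm.exists_mem {l : List C00} (h : Adm D σ K l) {a : C00} (ha : a ∈ l) :
    (∃ i, K ≤ i ∧ a ∈ D i) ∨ ∃ l', l' ≠ [] ∧ Adm D σ K l' ∧ a ∈ D (σ l') := by
  induction h with
  | nil => simp at ha
  | snoc h1 h2 h3 h4 ih =>
    rcases List.mem_append.1 ha with ha | ha
    · exact ih ha
    · obtain rfl := List.mem_singleton.1 ha
      rcases h4 with ⟨_, h⟩ | ⟨h, h'⟩
      · exact .inl h
      · exact .inr ⟨_, h, h1, h'⟩

/-- With a constant family the coding imposes nothing, so the results on `Adm` also serve the plain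
averages of the first layer. -/
lemma adm_const_iff {G : Set C00} {l : List C00} :
    Adm (fun _ => G) σ K l ↔ IsBlock l ∧ ∀ a ∈ l, a ∈ G := by
  constructor
  · intro h
    refine ⟨h.isBlock, fun a ha => ?_⟩
    rcases h.exists_mem ha with ⟨_, _, h⟩ | ⟨_, _, _, h⟩ <;> exact h
  · rintro ⟨h, h'⟩
    rw [adm_iff]
    exact ⟨h, fun _ => ⟨K, le_rfl, h' _ (List.getElem_mem _)⟩,
      fun _ _ _ => h' _ (List.getElem_mem _)⟩

/-- A set of functionals any member of which can be changed beyond `n` so as to vanish on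
`[n, q)`. -/
def Prolongs (D : Set C00) : Prop :=
  ∀ a ∈ D, ∀ n q, n ≤ q → ∃ a' ∈ D, (∀ i < n, a' i = a i) ∧ ∀ i, n ≤ i → i < q → a' i = 0

lemma Prolongs.exists_far {D : Set C00} (h : Prolongs D) (hne : D.Nonempty) (q : ℕ) :
    ∃ a ∈ D, ∀ i ∈ a.support, q ≤ i := by
  obtain ⟨a, ha⟩ := hne
  obtain ⟨a', ha', -, h0⟩ := h a ha 0 q (Nat.zero_le q)
  refine ⟨a', ha', fun i hi => ?_⟩
  by_contra! hq
  exact Finsupp.mem_support_iff.1 hi (h0 i (Nat.zero_le i) hq)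

/-- The last clause is what carries the induction: as long as nothing has reached `n`, the sequence
is unaltered and so are its codes. Once a member is altered all later codes may change, and the
later members have to be chosen anew, beyond `q`. -/
lemma Adm.prolong (hD0 : ∀ i, ∀ a ∈ D i, a ≠ 0) (hD : ∀ i, Prolongs (D i))
    (hne : ∀ l, Adm D σ K l → l ≠ [] → (D (σ l)).Nonempty) {n q : ℕ} (hnq : n ≤ q)
    {l : List C00} (hl : Adm D σ K l) :
    ∃ l', Adm D σ K l' ∧ l'.length = l.length ∧ (∀ i < n, l'.sum i = l.sum i) ∧
      (∀ i, n ≤ i → i < q → l'.sum i = 0) ∧ ((∀ a ∈ l, ∀ i ∈ a.support, i < n) → l' = l) := by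
  induction hl with
  | nil => exact ⟨[], .nil, rfl, by simp, by simp, by simp⟩
  | @snoc l x hl hx hlx hnext ih =>
    obtain ⟨l', hl', hlen, hlt, hge, heq⟩ := ih
    by_cases hsupp : ∀ a ∈ l, ∀ i ∈ a.support, i < n
    · obtain rfl := heq hsupp
      by_cases hxs : ∀ i ∈ x.support, i < n
      · refine ⟨_, .snoc hl hx hlx hnext, rfl, fun _ _ => rfl, fun i hi _ => ?_, fun _ => rfl⟩
        refine sum_apply_eq_zero fun a ha hia => hi.not_gt ?_
        rcases List.mem_append.1 ha with ha | ha
        · exact hsupp a ha i hia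
        · rw [List.mem_singleton.1 ha] at hia
          exact hxs i hia
      -- Here `x` is the first member to reach `n`. Its predecessors are unchanged, so it may be
      -- altered inside the same `D i`.
      · obtain ⟨x', hx', hx'n, hx'lt, hx'ge⟩ : ∃ x' ∈ nextSet D σ K l', x' ≠ 0 ∧
            (∀ i < n, x' i = x i) ∧ ∀ i, n ≤ i → i < q → x' i = 0 := by
          rcases hnext with ⟨h, i, hi, hxi⟩ | ⟨h, hxi⟩
          · obtain ⟨x', h1, h2⟩ := hD i x hxi n q hnq
            exact ⟨x', .inl ⟨h, i, hi, h1⟩, hD0 _ _ h1, h2⟩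
          · obtain ⟨x', h1, h2⟩ := hD _ x hxi n q hnq
            exact ⟨x', .inr ⟨h, h1⟩, hD0 _ _ h1, h2⟩
        refine ⟨l' ++ [x'], .snoc hl hx'n ?_ hx', by simp, fun i hi => ?_, fun i hi hiq => ?_,
          fun h => (hxs (h x (by simp))).elim⟩
        · intro a ha i hi j hj
          rcases lt_or_ge j n with hjn | hjn
          · refine hlx a ha i hi j ?_
            rw [Finsupp.mem_support_iff] at hj ⊢
            rwa [← hx'lt j hjn]
          · exact (hsupp a ha i hi).trans_le hjn
        · simp [hx'lt i hi]
        · have := sum_apply_eq_zero fun a ha hia => hi.not_gt (hsupp a ha i hia)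
          simp [this, hx'ge i hi hiq]
    -- An earlier member already reaches `n`, so `x` contributes nothing below `n` and any far
    -- member with the new code can replace it.
    · have hxs : ∀ i ∈ x.support, n < i := by
        push Not at hsupp
        obtain ⟨a, ha, i, hi, hin⟩ := hsupp
        exact fun j hj => hin.trans_lt (hlx a ha i hi j hj)
      have hl'0 : l' ≠ [] := by
        rintro rfl
        have : l = [] := List.eq_nil_of_length_eq_zero hlen.symm
        simp [this] at hsupp
      obtain ⟨p, hp⟩ := exists_support_lt_list l'
      obtain ⟨x', hx', hx's⟩ := (hD _).exists_far (hne l' hl' hl'0) (max p q)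
      have hx'q : ∀ i < q, x' i = 0 := fun i hi => by
        by_contra h
        exact (le_of_max_le_right (hx's i (Finsupp.mem_support_iff.2 h))).not_gt hi
      refine ⟨l' ++ [x'], .snoc hl' (hD0 _ _ hx') (fun a ha => precedes_of_support_lt (hp a ha)
        fun i hi => le_of_max_le_left (hx's i hi)) (.inr ⟨hl'0, hx'⟩), by simp [hlen],
        fun i hi => ?_, fun i hi hiq => ?_, fun h => (hsupp fun a ha => h a (by simp [ha])).elim⟩
      · have : x i = 0 := by
          by_contra h
          exact (hxs i (Finsupp.mem_support_iff.2 h)).not_gt hi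
        simp [hlt i hi, hx'q i (hi.trans_le hnq), this]
      · simp [hge i hi hiq, hx'q i hiq]

lemma exists_adm {Q : C00 → Prop}
    (h : ∀ l, Adm D σ K l → ∀ p, ∃ x ∈ nextSet D σ K l, x ≠ 0 ∧ (∀ i ∈ x.support, p ≤ i) ∧ Q x)
    (m p : ℕ) :
    ∃ l, Adm D σ K l ∧ l.length = m ∧ (∀ a ∈ l, ∀ i ∈ a.support, p ≤ i) ∧ ∀ a ∈ l, Q a := by
  induction m with
  | zero => exact ⟨[], .nil, rfl, by simp, by simp⟩
  | succ m ih =>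
    obtain ⟨l, hl, hlen, hp, hQ⟩ := ih
    obtain ⟨n, hn⟩ := exists_support_lt_list l
    obtain ⟨x, hx, hx0, hxs, hxQ⟩ := h l hl (max n p)
    refine ⟨l ++ [x], .snoc hl hx0 (fun a ha => precedes_of_support_lt (hn a ha)
      fun i hi => le_of_max_le_left (hxs i hi)) hx, by simp [hlen], fun a ha => ?_, fun a ha => ?_⟩
    · rcases List.mem_append.1 ha with ha | ha
      · exact hp a ha
      · rw [List.mem_singleton.1 ha]
        exact fun i hi => le_of_max_le_right (hxs i hi)
    · rcases List.mem_append.1 ha with ha | ha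
      · exact hQ a ha
      · rwa [List.mem_singleton.1 ha]

lemma Adm.mem_of_subset {H : Set C00} (hDH : ∀ i, D i ⊆ H) {l : List C00} (h : Adm D σ K l) :
    ∀ a ∈ l, a ∈ H := fun _ ha => by
  rcases h.exists_mem ha with ⟨i, _, h⟩ | ⟨_, _, _, h⟩ <;> exact hDH _ h

lemma mem_gam_iff {n : ℕ} (hn : 1 ≤ n) {a : C00} : a ∈ Gam D M σ n ↔
    ∃ l, Adm D σ (M n) l ∧ l.length = n ∧ a = (1 / f n) • l.sum := by
  constructor
  · rintro ⟨l, h, rfl, h'⟩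
    exact ⟨l, (isAdmissible_iff.1 h).2, rfl, h'⟩
  · rintro ⟨l, h, rfl, h'⟩
    exact ⟨l, isAdmissible_iff.2 ⟨List.length_pos_iff.1 hn, h⟩, rfl, h'⟩

/-- Prolonging preserves the length, hence both the factor `1 / f m` and the threshold `M m`. -/
lemma gam_prolongs (hD0 : ∀ i, ∀ a ∈ D i, a ≠ 0) (hD : ∀ i, Prolongs (D i))
    (hne : ∀ K l, Adm D σ K l → l ≠ [] → (D (σ l)).Nonempty) {m : ℕ} (hm : 1 ≤ m) :
    Prolongs (Gam D M σ m) := by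
  intro a ha n q hnq
  obtain ⟨l, hl, hlen, rfl⟩ := (mem_gam_iff hm).1 ha
  obtain ⟨l', hl', hlen', h1, h2, -⟩ := hl.prolong hD0 hD (hne _) hnq
  refine ⟨_, (mem_gam_iff hm).2 ⟨l', hl', hlen'.trans hlen, rfl⟩, fun i hi => ?_,
    fun i hi hiq => ?_⟩
  · simp [h1 i hi]
  · simp [h2 i hi hiq]

lemma gam_subset {H : Set C00} (hH : IsBaseSet H) (hDH : ∀ i, D i ⊆ H) {n : ℕ} (hn : 1 ≤ n) :
    Gam D M σ n ⊆ H := by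
  rintro a ha
  obtain ⟨l, hl, rfl, rfl⟩ := (mem_gam_iff hn).1 ha
  exact hH.div_f_mem l ⟨List.length_pos_iff.1 hn, hl.isBlock, hl.mem_of_subset hDH⟩

lemma abs_le_of_mem_gam {H : Set C00} (hH : IsBaseSet H) (hDH : ∀ i, D i ⊆ H) {n : ℕ}
    (hn : 1 ≤ n) {a : C00} (ha : a ∈ Gam D M σ n) (i : ℕ) : |a i| ≤ 1 / f n := by
  obtain ⟨l, hl, rfl, rfl⟩ := (mem_gam_iff hn).1 ha
  have h := abs_sum_apply_le hl.isBlock.2 zero_le_one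
    (fun a ha => hH.abs_le_one a (hl.mem_of_subset hDH a ha)) i
  have hf := f_pos hn
  rw [Finsupp.smul_apply, smul_eq_mul, abs_mul, abs_of_pos (by positivity)]
  exact mul_le_of_le_one_right (by positivity) h

lemma gam_nonempty (hD0 : ∀ i, ∀ a ∈ D i, a ≠ 0) (hD : ∀ i, Prolongs (D i))
    (hne : ∀ K l, Adm D σ K l → l ≠ [] → (D (σ l)).Nonempty) {n : ℕ} (hn : 1 ≤ n)
    (hn' : (D (M n)).Nonempty) : (Gam D M σ n).Nonempty := by
  obtain ⟨l, hl, hlen, -⟩ := exists_adm (D := D) (σ := σ) (K := M n) (Q := fun _ => True)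
    (fun l hl p => by
      rcases eq_or_ne l [] with rfl | h0
      · obtain ⟨a, ha, has⟩ := (hD _).exists_far hn' p
        exact ⟨a, .inl ⟨rfl, _, le_rfl, ha⟩, hD0 _ _ ha, has, trivial⟩
      · obtain ⟨a, ha, has⟩ := (hD _).exists_far (hne _ l hl h0) p
        exact ⟨a, .inr ⟨h0, ha⟩, hD0 _ _ ha, has, trivial⟩) n 0
  exact ⟨_, (mem_gam_iff hn).2 ⟨l, hl, hlen, rfl⟩⟩

end Adm

/-! ### The three layers over a set of functionals -/

/-- `setA` with the dual unit ball replaced by an arbitrary set `W` of functionals. -/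
def avgSet (H W : Set C00) (m : ℕ) : Set C00 :=
  {a | ∃ l : List C00, IsBlock l ∧ (∀ b ∈ l, b ∈ H ∩ W) ∧ l.length = m ∧
    a = (1 / (m : ℝ)) • l.sum}

/-- `setAt` with the dual unit ball replaced by `W`. -/
def longAvgSet (H W : Set C00) (m : ℕ) : Set C00 := {a | ∃ n, 2 ≤ n ∧ m ≤ n ∧ a ∈ avgSet H W n}

/-- `setB` with the dual unit ball replaced by `W`. -/
def innerSet (H : Set C00) (M : ℕ → ℕ) (σ : List C00 → ℕ) (W : Set C00) (m : ℕ) : Set C00 :=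
  {a | 2 ≤ m ∧ a ∈ Gam (longAvgSet H W) M σ m}

/-- `setC` with the dual unit ball replaced by `W`. -/
def outerSet (H : Set C00) (M : ℕ → ℕ) (σ : List C00 → ℕ) (W : Set C00) : Set C00 :=
  {a | ∃ n, 1 ≤ n ∧ a ∈ Gam (innerSet H M σ W) M σ n}

section Layers

variable {H W : Set C00} {M : ℕ → ℕ} {σ : List C00 → ℕ}

lemma avgSet_subset (hH : IsBaseSet H) {m : ℕ} (hm : 1 ≤ m) : avgSet H W m ⊆ H := by
  rintro a ⟨l, hl, hlW, rfl, rfl⟩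
  exact hH.average_mem l ⟨List.length_pos_iff.1 hm, hl, fun b hb => (hlW b hb).1⟩

lemma longAvgSet_subset (hH : IsBaseSet H) (m : ℕ) : longAvgSet H W m ⊆ H := by
  rintro a ⟨n, hn, _, ha⟩
  exact avgSet_subset hH (by omega) ha

lemma innerSet_subset (hH : IsBaseSet H) (m : ℕ) : innerSet H M σ W m ⊆ H := by
  rintro a ⟨hm, ha⟩
  exact gam_subset hH (longAvgSet_subset hH) (by omega) ha

lemma outerSet_subset (hH : IsBaseSet H) : outerSet H M σ W ⊆ H := by
  rintro a ⟨n, hn, ha⟩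
  exact gam_subset hH (innerSet_subset hH) hn ha

lemma Adm.mono {D D' : ℕ → Set C00} (h : ∀ i, D i ⊆ D' i) {K : ℕ} {l : List C00}
    (hl : Adm D σ K l) : Adm D' σ K l := by
  induction hl with
  | nil => exact .nil
  | snoc h1 h2 h3 h4 ih =>
    refine .snoc ih h2 h3 ?_
    rcases h4 with ⟨h4, i, hi, hx⟩ | ⟨h4, hx⟩
    · exact .inl ⟨h4, i, hi, h i hx⟩
    · exact .inr ⟨h4, h _ hx⟩

lemma gam_mono {D D' : ℕ → Set C00} (h : ∀ i, D i ⊆ D' i) {n : ℕ} (hn : 1 ≤ n) :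
    Gam D M σ n ⊆ Gam D' M σ n := by
  intro a ha
  obtain ⟨l, hl, h'⟩ := (mem_gam_iff hn).1 ha
  exact (mem_gam_iff hn).2 ⟨l, hl.mono h, h'⟩

lemma outerSet_mono {W' : Set C00} (h : W ⊆ W') : outerSet H M σ W ⊆ outerSet H M σ W' := by
  rintro a ⟨n, hn, ha⟩
  refine ⟨n, hn, gam_mono (fun i => ?_) hn ha⟩
  rintro b ⟨hi, hb⟩
  refine ⟨hi, gam_mono (fun j => ?_) (by omega) hb⟩
  rintro c ⟨k, hk, hjk, l, hl, hlW, h'⟩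
  exact ⟨k, hk, hjk, l, hl, fun b hb => ⟨(hlW b hb).1, h (hlW b hb).2⟩, h'⟩

/-- A set of functionals that is closed under truncation and contains the small multiples of the
coordinate functionals. -/
structure IsTruncationClosed (W : Set C00) : Prop where
  restrict_mem : ∀ a ∈ W, ∀ n, restrict (Set.Iio n) a ∈ W
  single_mem : ∀ i (r : ℝ), |r| ≤ 1 → Finsupp.single i r ∈ W

/-- An approximation of `eⱼ` within `ℓ₁` distance one has nonzero `j`-th coordinate, and a singleton
is an interval. -/
lemma exists_single_mem (hH : IsBaseSet H) (j : ℕ) : ∃ r : ℝ, r ≠ 0 ∧ Finsupp.single j r ∈ H := by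
  obtain ⟨a, ha, h⟩ := hH.dense (Finsupp.single j 1) (fun i => by
    rw [Finsupp.single_apply]; split_ifs <;> simp) 1 one_pos
  have h1 := (abs_apply_le_oneNorm (Finsupp.single j 1 - a) j).trans_lt h
  have haj : a j ≠ 0 := by
    intro h0
    simp [h0] at h1
  have hr : restrict {j} a = Finsupp.single j (a j) := by
    ext i
    by_cases hi : i = j
    · subst hi
      rw [restrict_apply_of_mem (by simp)]
      simp
    · rw [restrict_apply_of_notMem (by simpa using hi)]
      simp [Ne.symm hi]
  refine ⟨a j, haj, ?_⟩
  rw [← hr]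
  refine hH.restrict_mem a ha _ Set.ordConnected_singleton ?_
  rw [hr]
  simpa using haj

lemma IsTruncationClosed.inter_far (hW : IsTruncationClosed W) (hH : IsBaseSet H) (q : ℕ) :
    ∃ a ∈ H ∩ W, ∀ i ∈ a.support, q ≤ i := by
  obtain ⟨r, hr, h⟩ := exists_single_mem hH q
  have := hH.abs_le_one _ h q
  simp only [Finsupp.single_eq_same] at this
  refine ⟨_, ⟨h, hW.single_mem q r this⟩, fun i hi => ?_⟩
  rw [Finset.mem_singleton.1 (Finsupp.support_single_subset hi)]

lemma IsTruncationClosed.inter_prolongs (hW : IsTruncationClosed W) (hH : IsBaseSet H) :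
    Prolongs (H ∩ W) := by
  intro a ha n q hnq
  by_cases h : restrict (Set.Iio n) a = 0
  -- Zero is not in `H`, so a vanishing truncation is replaced by a member supported from `q` on.
  · obtain ⟨a', ha', h'⟩ := hW.inter_far hH q
    have h0 : ∀ i < q, a' i = 0 := fun i hi => by
      by_contra h0
      exact (h' i (Finsupp.mem_support_iff.2 h0)).not_gt hi
    refine ⟨a', ha', fun i hi => ?_, fun i _ hi => h0 i hi⟩
    rw [h0 i (hi.trans_le hnq), ← restrict_apply_of_mem (Set.mem_Iio.2 hi), h]
    rfl
  · refine ⟨_, ⟨hH.restrict_mem a ha.1 _ Set.ordConnected_Iio h, hW.restrict_mem a ha.2 n⟩,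
      fun i hi => restrict_apply_of_mem (Set.mem_Iio.2 hi) a, fun i hi _ => restrict_apply_of_notMem ?_ a⟩
    simpa using hi

lemma avgSet_prolongs (hW : IsTruncationClosed W) (hH : IsBaseSet H) (m : ℕ) :
    Prolongs (avgSet H W m) := by
  rintro a ⟨l, hl, hlW, hlen, rfl⟩ n q hnq
  obtain ⟨l', hl', hlen', h1, h2, -⟩ :=
    (adm_const_iff (σ := fun _ => 0) (K := 0) |>.2 ⟨hl, hlW⟩).prolong
      (fun _ a ha => hH.ne_zero a ha.1) (fun _ => hW.inter_prolongs hH)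
      (fun _ _ _ => (hW.inter_far hH 0).imp fun _ h => h.1) hnq
  obtain ⟨hl'1, hl'2⟩ := adm_const_iff.1 hl'
  refine ⟨_, ⟨l', hl'1, hl'2, hlen'.trans hlen, rfl⟩, fun i hi => ?_, fun i hi hiq => ?_⟩
  · simp [h1 i hi]
  · simp [h2 i hi hiq]

lemma avgSet_nonempty (hW : IsTruncationClosed W) (hH : IsBaseSet H) (m : ℕ) :
    (avgSet H W m).Nonempty := by
  obtain ⟨l, hl, hlen, -⟩ := exists_adm (D := fun _ => H ∩ W) (σ := fun _ => 0) (K := 0)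
    (Q := fun _ => True) (fun l hl p => by
      obtain ⟨a, ha, has⟩ := hW.inter_far hH p
      refine ⟨a, ?_, hH.ne_zero _ ha.1, has, trivial⟩
      rcases eq_or_ne l [] with h | h
      · exact .inl ⟨h, 0, le_rfl, ha⟩
      · exact .inr ⟨h, ha⟩) m 0
  exact ⟨_, l, (adm_const_iff.1 hl).1, (adm_const_iff.1 hl).2, hlen, rfl⟩

lemma longAvgSet_prolongs (hW : IsTruncationClosed W) (hH : IsBaseSet H) (m : ℕ) :
    Prolongs (longAvgSet H W m) := by
  rintro a ⟨k, hk, hmk, ha⟩ n q hnq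
  obtain ⟨a', ha', h⟩ := avgSet_prolongs hW hH k a ha n q hnq
  exact ⟨a', ⟨k, hk, hmk, ha'⟩, h⟩

lemma longAvgSet_nonempty (hW : IsTruncationClosed W) (hH : IsBaseSet H) (m : ℕ) :
    (longAvgSet H W m).Nonempty := by
  obtain ⟨a, ha⟩ := avgSet_nonempty hW hH (max 2 m)
  exact ⟨a, _, le_max_left _ _, le_max_right _ _, ha⟩

lemma innerSet_prolongs (hW : IsTruncationClosed W) (hH : IsBaseSet H) (m : ℕ) :
    Prolongs (innerSet H M σ W m) := by
  rintro a ⟨hm, ha⟩ n q hnq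
  obtain ⟨a', ha', h⟩ := gam_prolongs (fun i a ha => hH.ne_zero a (longAvgSet_subset hH i ha))
    (longAvgSet_prolongs hW hH) (fun _ _ _ _ => longAvgSet_nonempty hW hH _) (by omega) a ha n q hnq
  exact ⟨a', ⟨hm, ha'⟩, h⟩

lemma innerSet_nonempty (hW : IsTruncationClosed W) (hH : IsBaseSet H) {m : ℕ} (hm : 2 ≤ m) :
    (innerSet H M σ W m).Nonempty := by
  obtain ⟨a, ha⟩ := gam_nonempty (M := M) (σ := σ)
    (fun i a ha => hH.ne_zero a (longAvgSet_subset hH i ha))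
    (longAvgSet_prolongs hW hH) (fun _ _ _ _ => longAvgSet_nonempty hW hH _)
    (show 1 ≤ m by omega) (longAvgSet_nonempty hW hH _)
  exact ⟨a, hm, ha⟩

/-- Supports are counted from `1`, so a code exceeds `1`. This matters because the second layer is
empty at indices below `2`. -/
lemma IsCoding.two_le (hσ : IsCoding H σ) {l : List C00} (hl : l ∈ blocksIn H) : 2 ≤ σ l := by
  have h0 : l.getLast hl.1 ≠ 0 := hl.2.1.1 _ (List.getLast_mem hl.1)
  obtain ⟨i, hi⟩ := Finsupp.support_nonempty_iff.2 h0
  have := hσ.supp_lt l hl _ (by rw [List.getLast?_eq_getLast_of_ne_nil hl.1]; rfl) i hi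
  omega

lemma outerSet_prolongs (hW : IsTruncationClosed W) (hH : IsBaseSet H) (hσ : IsCoding H σ) :
    Prolongs (outerSet H M σ W) := by
  rintro a ⟨m, hm, ha⟩ n q hnq
  obtain ⟨a', ha', h⟩ := gam_prolongs (fun i a ha => hH.ne_zero a (innerSet_subset hH i ha))
    (innerSet_prolongs hW hH) (fun _ l hl hl0 => innerSet_nonempty hW hH
      (hσ.two_le ⟨hl0, hl.isBlock, hl.mem_of_subset (innerSet_subset hH)⟩)) hm a ha n q hnq
  exact ⟨a', ⟨m, hm, ha'⟩, h⟩

lemma abs_le_one_of_mem_outerSet (hH : IsBaseSet H) {a : C00} (ha : a ∈ outerSet H M σ W) (i : ℕ) :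
    |a i| ≤ 1 := hH.abs_le_one a (outerSet_subset hH ha) i

end Layers

/-! ### The seminorm given by a set of functionals -/

section FunctionalNorm

variable {A : Set C00}

lemma bddAbove_absValues (hA : ∀ a ∈ A, ∀ i, |a i| ≤ 1) (x : C00) : BddAbove (absValues A x) := by
  refine ⟨oneNorm x, ?_⟩
  rintro _ ⟨a, ha, rfl⟩
  simpa using abs_pair_le_mul_oneNorm_right (x := x) (hA a ha)

lemma max_supNorm_sSup_le_iff (hA : ∀ a ∈ A, ∀ i, |a i| ≤ 1) {x : C00} {t : ℝ} :
    max (supNorm x) (sSup (absValues A x)) ≤ t ↔ (∀ i, |x i| ≤ t) ∧ ∀ a ∈ A, |pair a x| ≤ t := by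
  rw [max_le_iff]
  constructor
  · rintro ⟨h1, h2⟩
    exact ⟨fun i => (abs_apply_le_supNorm x i).trans h1,
      fun a ha => (le_csSup (bddAbove_absValues hA x) ⟨a, ha, rfl⟩).trans h2⟩
  · rintro ⟨h1, h2⟩
    -- `Real.sSup_le` needs a nonnegative bound, since the supremum of the empty set is `0`; any
    -- coordinate of `x` supplies one.
    refine ⟨supNorm_le h1, Real.sSup_le ?_ ((abs_nonneg _).trans (h1 0))⟩
    rintro _ ⟨a, ha, rfl⟩
    exact h2 a ha

/-- The seminorm `x ↦ max (‖x‖_∞, ‖x‖_A)`. -/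
noncomputable def functionalNorm (A : Set C00) (hA : ∀ a ∈ A, ∀ i, |a i| ≤ 1) :
    Seminorm ℝ C00 :=
  Seminorm.ofSMulLE (fun x => max (supNorm x) (sSup (absValues A x)))
    (le_antisymm ((max_supNorm_sSup_le_iff hA).2 (by simp))
      (le_max_of_le_left (supNorm_nonneg _)))
    (fun x y => by
      have hx := (max_supNorm_sSup_le_iff hA (x := x)).1 le_rfl
      have hy := (max_supNorm_sSup_le_iff hA (x := y)).1 le_rfl
      refine (max_supNorm_sSup_le_iff hA).2 ⟨fun i => ?_, fun a ha => ?_⟩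
      · exact (abs_add_le _ _).trans (add_le_add (hx.1 i) (hy.1 i))
      · rw [pair_add_right]
        exact (abs_add_le _ _).trans (add_le_add (hx.2 a ha) (hy.2 a ha)))
    (fun r x => by
      have hx := (max_supNorm_sSup_le_iff hA (x := x)).1 le_rfl
      refine (max_supNorm_sSup_le_iff hA).2 ⟨fun i => ?_, fun a ha => ?_⟩
      · rw [Finsupp.smul_apply, smul_eq_mul, abs_mul, Real.norm_eq_abs]
        exact mul_le_mul_of_nonneg_left (hx.1 i) (abs_nonneg _)
      · rw [pair_smul_right, abs_mul, Real.norm_eq_abs]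
        exact mul_le_mul_of_nonneg_left (hx.2 a ha) (abs_nonneg _))

lemma functionalNorm_le_iff (hA : ∀ a ∈ A, ∀ i, |a i| ≤ 1) {x : C00} {t : ℝ} :
    functionalNorm A hA x ≤ t ↔ (∀ i, |x i| ≤ t) ∧ ∀ a ∈ A, |pair a x| ≤ t :=
  max_supNorm_sSup_le_iff hA

lemma functionalNorm_restrict_Iio_le (hA : ∀ a ∈ A, ∀ i, |a i| ≤ 1) (hP : Prolongs A) (n : ℕ)
    (x : C00) : functionalNorm A hA (restrict (Set.Iio n) x) ≤ functionalNorm A hA x := by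
  have hx := (functionalNorm_le_iff hA (x := x)).1 le_rfl
  refine (functionalNorm_le_iff hA).2 ⟨fun i => ?_, fun a ha => ?_⟩
  · exact (abs_restrict_apply_le _ x i).trans (hx.1 i)
  · obtain ⟨q, hq⟩ := exists_support_lt x
    -- Vanishing on `[n, q)`, with `q` past the support of `x`, makes `a'` act on `x` exactly as the
    -- truncation of `a` does.
    obtain ⟨a', ha', h1, h2⟩ := hP a ha n (max n q) (le_max_left _ _)
    have : pair a (restrict (Set.Iio n) x) = pair a' x := by
      rw [← pair_restrict]
      refine pair_congr_left fun i hi => ?_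
      by_cases hin : i < n
      · rw [restrict_apply_of_mem (Set.mem_Iio.2 hin), h1 i hin]
      · rw [restrict_apply_of_notMem (by simpa using hin),
          h2 i (not_lt.1 hin) (lt_max_of_lt_right (hq i hi))]
    rw [this]
    exact hx.2 a' ha'

end FunctionalNorm

/-! ### The fixed point -/

/-- A seminorm that solves the fixed point equation and for which the initial projections are
contractions. -/
structure IsSolution (H : Set C00) (M : ℕ → ℕ) (σ : List C00 → ℕ) (N : Seminorm ℝ C00) :
    Prop where
  apply_eq : ∀ x, N x = max (supNorm x) (sSup (absValues (setC H M σ N) x))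
  le_iff : ∀ x t, N x ≤ t ↔ (∀ i, |x i| ≤ t) ∧ ∀ a ∈ setC H M σ N, |pair a x| ≤ t
  restrict_le : ∀ n x, N (restrict (Set.Iio n) x) ≤ N x

section FixedPoint

variable {H : Set C00} {M : ℕ → ℕ} {σ : List C00 → ℕ}

/-- The seminorm given by the third layer over `W`. -/
noncomputable def layerNorm (hH : IsBaseSet H) (M : ℕ → ℕ) (σ : List C00 → ℕ) (W : Set C00) :
    Seminorm ℝ C00 :=
  functionalNorm (outerSet H M σ W) fun _ ha => abs_le_one_of_mem_outerSet hH ha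

/-- The functionals all of whose truncations are dominated by the seminorm of `W`. -/
noncomputable def dualStep (hH : IsBaseSet H) (M : ℕ → ℕ) (σ : List C00 → ℕ) :
    Set C00 →o Set C00 where
  toFun W := {a | ∀ n x, |pair (restrict (Set.Iio n) a) x| ≤ layerNorm hH M σ W x}
  monotone' W W' h a ha n x := by
    refine (ha n x).trans ((functionalNorm_le_iff _).2 ?_)
    have := (functionalNorm_le_iff (A := outerSet H M σ W')
      (fun _ ha => abs_le_one_of_mem_outerSet hH ha) (x := x)).1 le_rfl
    exact ⟨this.1, fun b hb => this.2 b (outerSet_mono h hb)⟩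

/-- Truncations are built into `dualStep` because closure under them must be known before the
projections can be shown to be contractive. Once they are, the requirement is automatic and the
fixed point is the full dual ball. -/
theorem exists_isSolution (hH : IsBaseSet H) (hσ : IsCoding H σ) :
    ∃ N : Seminorm ℝ C00, IsSolution H M σ N := by
  set W := OrderHom.lfp (dualStep hH M σ) with hWdef
  have hfix : ∀ a, a ∈ W ↔ ∀ n x, |pair (restrict (Set.Iio n) a) x| ≤ layerNorm hH M σ W x := by
    intro a
    conv_lhs => rw [hWdef, ← OrderHom.map_lfp]
    rfl
  have hW : IsTruncationClosed W := by
    constructor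
    · intro a ha n
      rw [hfix] at ha ⊢
      intro k x
      rw [restrict_restrict, Set.Iio_inter_Iio]
      exact ha _ x
    · intro i r hr
      rw [hfix]
      intro n x
      have hx := ((functionalNorm_le_iff _).1 (le_refl (layerNorm hH M σ W x))).1 i
      rw [pair_restrict, pair_single_left, abs_mul]
      calc |r| * |restrict (Set.Iio n) x i| ≤ 1 * |x i| :=
            mul_le_mul hr (abs_restrict_apply_le _ x i) (abs_nonneg _) zero_le_one
        _ ≤ _ := by rw [one_mul]; exact hx
  have hmono : ∀ n x, layerNorm hH M σ W (restrict (Set.Iio n) x) ≤ layerNorm hH M σ W x :=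
    functionalNorm_restrict_Iio_le _ (outerSet_prolongs hW hH hσ)
  have hball : dualBall (layerNorm hH M σ W) = W := by
    ext a
    rw [hfix]
    constructor
    · intro h n x
      rw [pair_restrict]
      exact (h _).trans (hmono n x)
    · intro h x
      obtain ⟨n, hn⟩ := exists_restrict_Iio_eq a
      have := h n x
      rwa [hn] at this
  have hC : setC H M σ (layerNorm hH M σ W) = outerSet H M σ W := by
    conv_rhs => rw [← hball]
    rfl
  exact ⟨layerNorm hH M σ W, fun x => by rw [hC]; rfl,
    fun x t => by rw [hC]; exact functionalNorm_le_iff _, hmono⟩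

end FixedPoint

namespace IsSolution

variable {H : Set C00} {M : ℕ → ℕ} {σ : List C00 → ℕ} {N : Seminorm ℝ C00}

lemma abs_apply_le (h : IsSolution H M σ N) (x : C00) (i : ℕ) : |x i| ≤ N x :=
  ((h.le_iff x _).1 le_rfl).1 i

lemma setC_subset (h : IsSolution H M σ N) : setC H M σ N ⊆ dualBall N :=
  fun a ha x => ((h.le_iff x _).1 le_rfl).2 a ha

lemma setB_subset_setC (hH : IsBaseSet H) (hM : IsIndexSeq M) (m : ℕ) :
    setB H M σ N m ⊆ setC H M σ N := by
  intro a ha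
  have ha0 : a ≠ 0 := hH.ne_zero a (innerSet_subset (W := dualBall N) hH m ha)
  refine ⟨1, le_rfl, (mem_gam_iff le_rfl).2 ⟨[a], ?_, rfl, by simp [f_one]⟩⟩
  exact .snoc .nil ha0 (by simp) (.inl ⟨rfl, m, hM.2 ▸ ha.1, ha⟩)

lemma setB_subset (h : IsSolution H M σ N) (hH : IsBaseSet H) (hM : IsIndexSeq M) (m : ℕ) :
    setB H M σ N m ⊆ dualBall N := (setB_subset_setC hH hM m).trans h.setC_subset

lemma abs_le_one_of_mem_setC (hH : IsBaseSet H) {a : C00} (ha : a ∈ setC H M σ N) (i : ℕ) :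
    |a i| ≤ 1 := abs_le_one_of_mem_outerSet (W := dualBall N) hH ha i

lemma apply_unitVec (h : IsSolution H M σ N) (hH : IsBaseSet H) (i : ℕ) : N (unitVec i) = 1 := by
  refine le_antisymm ((h.le_iff _ _).2 ⟨fun j => ?_, fun a ha => ?_⟩) ?_
  · rw [unitVec, Finsupp.single_apply]
    split_ifs <;> simp
  · rw [pair_unitVec_right]
    exact abs_le_one_of_mem_setC hH ha i
  · simpa [unitVec] using h.abs_apply_le (unitVec i) i

end IsSolution

/-! ### The completion -/

section Completion

variable {N : Seminorm ℝ C00}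

/-- The embedding into the completion as a linear map. -/
noncomputable def toComplₗ (N : Seminorm ℝ C00) : C00 →ₗ[ℝ] CompletionOf N where
  toFun := toCompl N
  map_add' x y := UniformSpace.Completion.coe_add (α := Space N) x y
  map_smul' r x := UniformSpace.Completion.coe_smul (X := Space N) r x

lemma toComplₗ_apply (x : C00) : toComplₗ N x = toCompl N x := rfl

lemma norm_toCompl (x : C00) : ‖toCompl N x‖ = N x := UniformSpace.Completion.norm_coe _

lemma denseRange_toCompl : DenseRange (toCompl N) :=
  UniformSpace.Completion.denseRange_coe (α := Space N)

/-- The `i`-th coordinate functional on the completion. -/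
noncomputable def complCoord (h : ∀ x i, |x i| ≤ N x) (i : ℕ) : StrongDual ℝ (CompletionOf N) :=
  ContinuousLinearMap.extend
    (LinearMap.mkContinuous
      (show Space N →ₗ[ℝ] ℝ from
        { toFun := fun x => (show C00 from x) i
          map_add' := fun _ _ => rfl
          map_smul' := fun _ _ => rfl }) 1
      (fun x => by rw [one_mul]; exact h x i))
    (UniformSpace.Completion.toComplL (𝕜 := ℝ) (E := Space N))

lemma complCoord_toCompl (h : ∀ x i, |x i| ≤ N x) (i : ℕ) (x : C00) :
    complCoord h i (toCompl N x) = x i :=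
  ContinuousLinearMap.extend_eq (e := UniformSpace.Completion.toComplL (𝕜 := ℝ) (E := Space N)) _
    (UniformSpace.Completion.denseRange_coe (α := Space N))
    (UniformSpace.Completion.isUniformInducing_coe (Space N)) x

lemma norm_complCoord_apply_le (h : ∀ x i, |x i| ≤ N x) (i : ℕ) (z : CompletionOf N) :
    ‖complCoord h i z‖ ≤ ‖z‖ := by
  refine denseRange_toCompl.induction_on z
    (isClosed_le (complCoord h i).continuous.norm continuous_norm) fun x => ?_
  rw [complCoord_toCompl, norm_toCompl]
  exact h x i

lemma restrict_Iio_eq_sum (n : ℕ) (x : C00) :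
    restrict (Set.Iio n) x = ∑ i ∈ Finset.range n, x i • unitVec i := by
  ext j
  rw [Finsupp.finsetSum_apply]
  by_cases hj : j < n
  · rw [restrict_apply_of_mem (Set.mem_Iio.2 hj), Finset.sum_eq_single j]
    · simp [unitVec]
    · intro i _ hij
      simp [unitVec, hij]
    · simp [hj]
  · rw [restrict_apply_of_notMem (by simpa using hj)]
    refine (Finset.sum_eq_zero fun i hi => ?_).symm
    have : i ≠ j := by rintro rfl; exact hj (Finset.mem_range.1 hi)
    simp [unitVec, this]

lemma toCompl_sum_smul (s : Finset ℕ) (a : ℕ → ℝ) :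
    toCompl N (∑ i ∈ s, a i • unitVec i) = ∑ i ∈ s, a i • toCompl N (unitVec i) := by
  simp only [← toComplₗ_apply, map_sum, map_smul]

lemma sum_complCoord_toCompl (h : ∀ x i, |x i| ≤ N x) (n : ℕ) (x : C00) :
    ∑ i ∈ Finset.range n, complCoord h i (toCompl N x) • toCompl N (unitVec i) =
      toCompl N (restrict (Set.Iio n) x) := by
  rw [restrict_Iio_eq_sum, toCompl_sum_smul]
  simp only [complCoord_toCompl]

lemma norm_sum_complCoord_le (h : ∀ x i, |x i| ≤ N x)
    (hr : ∀ n x, N (restrict (Set.Iio n) x) ≤ N x) (n : ℕ) (z : CompletionOf N) :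
    ‖∑ i ∈ Finset.range n, complCoord h i z • toCompl N (unitVec i)‖ ≤ ‖z‖ := by
  refine denseRange_toCompl.induction_on z (isClosed_le ?_ continuous_norm) fun x => ?_
  · fun_prop
  · rw [sum_complCoord_toCompl, norm_toCompl, norm_toCompl]
    exact hr n x

/-- The partial sum operators are contractions, and on the dense set of finitely supported vectors
they are eventually the identity. -/
lemma tendsto_sum_complCoord (h : ∀ x i, |x i| ≤ N x)
    (hr : ∀ n x, N (restrict (Set.Iio n) x) ≤ N x) (z : CompletionOf N) :
    Filter.Tendsto (fun n => ∑ i ∈ Finset.range n, complCoord h i z • toCompl N (unitVec i))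
      Filter.atTop (nhds z) := by
  rw [Metric.tendsto_atTop]
  intro ε hε
  obtain ⟨x, hx⟩ := denseRange_toCompl.exists_dist_lt z (half_pos hε)
  obtain ⟨n, hn⟩ := exists_support_lt x
  refine ⟨n, fun k hk => ?_⟩
  have h1 := norm_sum_complCoord_le h hr k (z - toCompl N x)
  simp only [map_sub, sub_smul, Finset.sum_sub_distrib] at h1
  rw [sum_complCoord_toCompl,
    restrict_eq_self fun i hi => Set.mem_Iio.2 ((hn i hi).trans_le hk)] at h1
  rw [dist_eq_norm] at hx ⊢
  calc _ = ‖(∑ i ∈ Finset.range k, complCoord h i z • toCompl N (unitVec i) - toCompl N x) -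
        (z - toCompl N x)‖ := by rw [sub_sub_sub_cancel_right]
    _ ≤ _ := norm_sub_le _ _
    _ < ε := by linarith

/-- The unit vectors as a Schauder basis of the completion. -/
noncomputable def complBasis (h : ∀ x i, |x i| ≤ N x)
    (hr : ∀ n x, N (restrict (Set.Iio n) x) ≤ N x) : SchauderBasis ℝ (CompletionOf N) where
  basis i := toCompl N (unitVec i)
  coord := complCoord h
  ortho i j := by
    rw [complCoord_toCompl, unitVec]
    rcases eq_or_ne i j with rfl | hij
    · simp
    · simp [hij]
  expansion z := by
    rw [HasSum, SummationFilter.conditional_filter_eq_map_range, Filter.tendsto_map'_iff]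
    exact tendsto_sum_complCoord h hr z

theorem classN_of_forall (h : ∀ x i, |x i| ≤ N x)
    (hr : ∀ n x, N (restrict (Set.Iio n) x) ≤ N x) (h1 : ∀ i, N (unitVec i) = 1) :
    ClassN N := by
  refine ⟨fun x hx => ?_, complBasis h hr, fun _ => rfl, fun i => ?_, fun n => ?_, fun i => ?_⟩
  · ext i
    have := h x i
    rw [hx] at this
    exact abs_nonpos_iff.1 this
  · exact (norm_toCompl _).trans (h1 i)
  · refine ContinuousLinearMap.opNorm_le_bound _ zero_le_one fun z => ?_
    rw [SchauderBasis.proj_apply, one_mul]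
    exact norm_sum_complCoord_le h hr n z
  · refine le_antisymm (ContinuousLinearMap.opNorm_le_bound _ zero_le_one fun z => ?_) ?_
    · rw [one_mul]
      exact norm_complCoord_apply_le h i z
    · have h2 := (complCoord h i).le_opNorm (toCompl N (unitVec i))
      rw [complCoord_toCompl, norm_toCompl, h1] at h2
      have h3 : 1 ≤ ‖complCoord h i‖ := by simpa [unitVec] using h2
      exact h3

end Completion

/-! ### Counting the pairs of blocks that meet -/

open Classical in
/-- The members of `vs` whose support meets that of `g`. -/
noncomputable def meeting (g : C00) (vs : List C00) : List C00 :=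
  vs.filter fun v => ∃ i ∈ g.support, i ∈ v.support

lemma pair_meeting_sum (g : C00) (vs : List C00) : pair g (meeting g vs).sum = pair g vs.sum := by
  classical
  induction vs with
  | nil => rfl
  | cons v vs ih =>
    rw [List.sum_cons, pair_add_right, ← ih, meeting, List.filter_cons]
    split_ifs with h
    · rw [List.sum_cons, pair_add_right]
      rfl
    · have h0 : pair g v = 0 := pair_eq_zero (by simpa using h)
      rw [h0, zero_add]
      rfl

lemma sum_length_meeting_le {gs vs : List C00} (hg : gs.Pairwise Precedes)
    (hv : vs.Pairwise Precedes) :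
    (gs.map fun g => (meeting g vs).length).sum ≤ gs.length + vs.length := by
  classical
  induction gs generalizing vs with
  | nil => simp
  | cons g gs ihg =>
    induction vs with
    | nil => simp [meeting]
    | cons v vs ihv =>
      rw [List.pairwise_cons] at hg hv
      -- Each step discards one block. If `g` meets nothing beyond `v`, discard `g` at the cost of
      -- one pair. Otherwise `g` reaches past `v`, so no later functional meets `v`, and `v` is
      -- discarded at the cost of one pair.
      by_cases h : meeting g vs = []
      · have h1 := ihg (vs := v :: vs) hg.2 (List.pairwise_cons.2 hv)
        have h2 : (meeting g (v :: vs)).length ≤ 1 := by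
          rw [meeting, List.filter_cons]
          split_ifs
          · change (v :: meeting g vs).length ≤ 1
            simp [h]
          · change (meeting g vs).length ≤ 1
            simp [h]
        simp only [List.map_cons, List.sum_cons, List.length_cons] at h1 ⊢
        omega
      · obtain ⟨v', hv'⟩ := List.exists_mem_of_ne_nil _ h
        obtain ⟨hv'm, i, hi, hi'⟩ : v' ∈ vs ∧ ∃ i ∈ g.support, i ∈ v'.support := by
          simpa [meeting] using hv'
        have h1 : ∀ g' ∈ gs, meeting g' (v :: vs) = meeting g' vs := by
          intro g' hg'
          rw [meeting, List.filter_cons, if_neg]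
          · rfl
          · simp only [decide_eq_true_eq, not_exists, not_and]
            intro j hj hj'
            exact lt_asymm (hg.1 g' hg' i hi j hj) (hv.1 v' hv'm j hj' i hi')
        have h2 : (meeting g (v :: vs)).length ≤ (meeting g vs).length + 1 := by
          rw [meeting, List.filter_cons]
          split_ifs
          · exact le_rfl
          · exact Nat.le_succ _
        have h3 := ihv hv.2
        rw [List.map_cons, List.sum_cons] at h3 ⊢
        rw [List.map_congr_left fun g' hg' => by rw [h1 g' hg']]
        simp only [List.length_cons] at h3 ⊢
        omega

lemma abs_list_sum_le {ι : Type*} (l : List ι) (u : ι → ℝ) :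
    |(l.map u).sum| ≤ (l.map fun i => |u i|).sum := by
  induction l with
  | nil => simp
  | cons i l ih => simpa using (abs_add_le _ _).trans (by gcongr)

/-! ### Functionals on sums of blocks -/

/-- The functional `g` is at most `τ n + κ` on the sum of `n` blocks of norm at most one. -/
def BlockBound (N : Seminorm ℝ C00) (g : C00) (τ κ : ℝ) : Prop :=
  ∀ vs : List C00, vs.Pairwise Precedes → (∀ v ∈ vs, N v ≤ 1) →
    |pair g vs.sum| ≤ τ * vs.length + κ

section BlockBound

variable {N : Seminorm ℝ C00} {g : C00} {τ κ : ℝ}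

lemma BlockBound.mono (h : BlockBound N g τ κ) {τ' κ' : ℝ} (hτ : τ ≤ τ') (hκ : κ ≤ κ') :
    BlockBound N g τ' κ' := fun vs hvs hN => (h vs hvs hN).trans (by gcongr)

lemma BlockBound.smul (h : BlockBound N g τ κ) {r : ℝ} (hr : 0 ≤ r) :
    BlockBound N (r • g) (r * τ) (r * κ) := fun vs hvs hN => by
  rw [pair_smul_left, abs_mul, abs_of_nonneg hr, mul_assoc, ← mul_add]
  exact mul_le_mul_of_nonneg_left (h vs hvs hN) hr

lemma blockBound_of_mem_dualBall (h : g ∈ dualBall N) : BlockBound N g 1 0 := by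
  intro vs _ hN
  rw [pair_list_sum_right, one_mul, add_zero]
  refine (abs_list_sum_le vs _).trans ?_
  have := List.sum_le_card_nsmul (vs.map fun v => |pair g v|) 1 (by
    intro r hr
    obtain ⟨v, hv, rfl⟩ := List.mem_map.1 hr
    exact (h v).trans (hN v hv))
  simpa using this

/-- Each functional sees only the blocks it meets. Since the meeting pairs number at most the sum of
the two lengths, summing successive functionals leaves the slope `τ` unchanged and only the constant
term grows. -/
lemma BlockBound.list_sum {gs : List C00} (hgs : gs.Pairwise Precedes) (hτ : 0 ≤ τ)
    (h : ∀ g ∈ gs, BlockBound N g τ κ) : BlockBound N gs.sum τ ((κ + τ) * gs.length) := by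
  classical
  intro vs hvs hN
  have h1 : |pair gs.sum vs.sum| ≤ (gs.map fun g => τ * (meeting g vs).length + κ).sum := by
    rw [pair_list_sum_left]
    refine (abs_list_sum_le gs _).trans (List.sum_le_sum fun g hg => ?_)
    rw [← pair_meeting_sum]
    exact h g hg _ (hvs.sublist List.filter_sublist)
      fun v hv => hN v (List.mem_of_mem_filter hv)
  have h2 : (gs.map fun g => τ * ((meeting g vs).length : ℝ) + κ).sum =
      τ * ((gs.map fun g => (meeting g vs).length).sum : ℕ) + κ * gs.length := by
    clear h h1 hgs
    induction gs with
    | nil => simp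
    | cons g gs ih =>
      simp only [List.map_cons, List.sum_cons, List.length_cons, ih]
      push_cast
      ring
  have h3 : ((gs.map fun g => (meeting g vs).length).sum : ℝ) ≤ gs.length + vs.length := by
    exact_mod_cast sum_length_meeting_le hgs hvs
  rw [h2] at h1
  have := mul_le_mul_of_nonneg_left h3 hτ
  linarith

end BlockBound

section Layers

variable {H : Set C00} {M : ℕ → ℕ} {σ : List C00 → ℕ} {N : Seminorm ℝ C00}

/-- Averaging `n ≥ 2` functionals divides the slope by `n`. This is the only source of a slope below
one. -/
lemma blockBound_of_mem_setAt {a : C00} {m : ℕ} (ha : a ∈ setAt H N m) :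
    BlockBound N a (1 / 2) 1 := by
  obtain ⟨n, hn, -, l, hl, hlW, rfl, rfl⟩ := ha
  have hn' : (2 : ℝ) ≤ l.length := by exact_mod_cast hn
  refine ((BlockBound.list_sum hl.2 zero_le_one fun b hb =>
    blockBound_of_mem_dualBall (hlW b hb).2).smul (by positivity)).mono ?_ ?_
  · rw [mul_one]
    exact one_div_le_one_div_of_le two_pos hn'
  · rw [zero_add, one_mul, one_div, inv_mul_cancel₀ (by linarith)]

lemma setB_exists {b : C00} {m : ℕ} (hb : b ∈ setB H M σ N m) :
    ∃ l : List C00, IsBlock l ∧ l.length = m ∧ b = (1 / f m) • l.sum ∧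
      ∀ a ∈ l, ∃ k, a ∈ setAt H N k := by
  obtain ⟨hm, hb⟩ := hb
  obtain ⟨l, hl, hlen, hb⟩ := (mem_gam_iff (by omega)).1 hb
  refine ⟨l, hl.isBlock, hlen, hb, fun a ha => ?_⟩
  rcases hl.exists_mem ha with ⟨i, _, h⟩ | ⟨_, _, _, h⟩
  exacts [⟨_, h⟩, ⟨_, h⟩]

lemma blockBound_of_mem_setB {b : C00} {m : ℕ} (hb : b ∈ setB H M σ N m) :
    BlockBound N b (1 / 2) (2 * m) := by
  obtain ⟨l, hl, rfl, rfl, hla⟩ := setB_exists hb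
  have hm : 1 ≤ l.length := le_trans one_le_two hb.1
  have hf := one_div_f_le_one hm
  have hf0 : 0 ≤ 1 / f l.length := by have := f_pos hm; positivity
  refine ((BlockBound.list_sum hl.2 (τ := 1 / 2) (κ := 1) (by norm_num) fun a ha => by
    obtain ⟨k, hk⟩ := hla a ha
    exact blockBound_of_mem_setAt hk).smul hf0).mono ?_ ?_
  · linarith
  · have : (0 : ℝ) ≤ l.length := by positivity
    nlinarith

end Layers

/-! ### Averages of far blocks -/

section Spread

variable {N : Seminorm ℝ C00} {ψ : C00 →ₗ[ℝ] ℝ} {t : ℝ}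

/-- Arbitrarily far out there are vectors of norm at most one at which `ψ` equals `t`. -/
def Spread (N : Seminorm ℝ C00) (ψ : C00 →ₗ[ℝ] ℝ) (t : ℝ) : Prop :=
  ∀ q, ∃ x, ψ x = t ∧ N x ≤ 1 ∧ ∀ i ∈ x.support, q ≤ i

lemma support_list_sum_ge {ys : List C00} {q : ℕ} (h : ∀ y ∈ ys, ∀ i ∈ y.support, q ≤ i) :
    ∀ i ∈ ys.sum.support, q ≤ i := fun i hi => by
  obtain ⟨y, hy, hi⟩ := exists_mem_support_of_mem_support_sum hi
  exact h y hy i hi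

lemma average_spec {ys : List C00} {q : ℕ} (hne : ys ≠ [])
    (h : ∀ y ∈ ys, ψ y = t ∧ N y ≤ 1 ∧ ∀ i ∈ y.support, q ≤ i) :
    ψ ((1 / (ys.length : ℝ)) • ys.sum) = t ∧ N ((1 / (ys.length : ℝ)) • ys.sum) ≤ 1 ∧
      ∀ i ∈ ((1 / (ys.length : ℝ)) • ys.sum).support, q ≤ i := by
  have hL : (0 : ℝ) < ys.length := by exact_mod_cast List.length_pos_iff.2 hne
  have h1 : ψ ys.sum = ys.length * t ∧ N ys.sum ≤ ys.length := by
    clear hne hL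
    induction ys with
    | nil => simp
    | cons y ys ih =>
      obtain ⟨ih1, ih2⟩ := ih fun z hz => h z (by simp [hz])
      obtain ⟨hy1, hy2, -⟩ := h y (by simp)
      constructor
      · simp only [List.sum_cons, map_add, ih1, hy1, List.length_cons]
        push_cast
        ring
      · rw [List.sum_cons]
        refine (map_add_le_add N _ _).trans ?_
        simp only [List.length_cons]
        push_cast
        linarith
  refine ⟨?_, ?_, fun i hi => ?_⟩
  · rw [map_smul, h1.1, smul_eq_mul]
    field_simp
  · rw [map_smul_eq_mul, Real.norm_of_nonneg (by positivity), one_div_mul_eq_div,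
      div_le_one hL]
    exact h1.2
  · exact support_list_sum_ge (fun y hy => (h y hy).2.2) i (Finsupp.support_smul hi)

lemma Spread.exists_list (h : Spread N ψ t) (L q : ℕ) :
    ∃ ys : List C00, ys.length = L ∧ ys.Pairwise Precedes ∧
      ∀ y ∈ ys, ψ y = t ∧ N y ≤ 1 ∧ ∀ i ∈ y.support, q ≤ i := by
  induction L generalizing q with
  | zero => exact ⟨[], rfl, .nil, by simp⟩
  | succ L ih =>
    obtain ⟨y, hy1, hy2, hy3⟩ := h q
    obtain ⟨p, hp⟩ := exists_support_lt y
    obtain ⟨ys, hlen, hpw, hys⟩ := ih (max p q)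
    refine ⟨y :: ys, by simp [hlen], List.pairwise_cons.2 ⟨fun z hz =>
      precedes_of_support_lt hp fun i hi => le_of_max_le_left ((hys z hz).2.2 i hi), hpw⟩,
      fun z hz => ?_⟩
    rcases List.mem_cons.1 hz with rfl | hz
    · exact ⟨hy1, hy2, hy3⟩
    · exact ⟨(hys z hz).1, (hys z hz).2.1, fun i hi => le_of_max_le_right ((hys z hz).2.2 i hi)⟩

/-- One step of the gliding hump: on a single vector `y`, the functionals of intermediate index
contribute at most one each, those of large index almost nothing. -/
lemma abs_pair_list_sum_le {μ : C00 → ℕ} {y : C00} {Q Q' : ℕ} (hQ : Q ≤ Q') {δ : ℝ} (hδ : 0 ≤ δ)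
    {gs : List C00} (h1 : ∀ g ∈ gs, |pair g y| ≤ 1)
    (h2 : ∀ g ∈ gs, Q' < μ g → |pair g y| ≤ δ) :
    |pair gs.sum y| + gs.countP (fun g => Q' < μ g) ≤
      |pair (gs.filter fun g => μ g ≤ Q).sum y| + δ * gs.length +
        gs.countP (fun g => Q < μ g) := by
  -- The count of functionals of index above the cutoff acts as a potential: one of intermediate
  -- index costs at most one and lowers the count by one, so over successive vectors these costs
  -- telescope.
  have key : |pair gs.sum y - pair (gs.filter fun g => μ g ≤ Q).sum y| +
      gs.countP (fun g => Q' < μ g) ≤ δ * gs.length + gs.countP (fun g => Q < μ g) := by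
    induction gs with
    | nil => simp
    | cons g gs ih =>
      have ih := ih (fun g' hg' => h1 g' (by simp [hg'])) fun g' hg' => h2 g' (by simp [hg'])
      have hg1 := h1 g (by simp)
      have hg2 := h2 g (by simp)
      rw [List.filter_cons, List.countP_cons, List.countP_cons, List.sum_cons, pair_add_left]
      simp only [decide_eq_true_eq, List.length_cons]
      set A := pair gs.sum y
      set B := pair (gs.filter fun g => μ g ≤ Q).sum y with hB
      by_cases hQg : μ g ≤ Q
      · rw [if_pos hQg, if_neg (by omega), if_neg (by omega), List.sum_cons, pair_add_left,
          add_sub_add_left_eq_sub, ← hB]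
        push_cast
        linarith
      · rw [if_neg hQg, if_pos (show Q < μ g by omega), ← hB]
        have h3 : |pair g y + A - B| ≤ |pair g y| + |A - B| := by
          rw [add_sub_assoc]
          exact abs_add_le _ _
        by_cases hQg' : Q' < μ g
        · rw [if_pos hQg']
          have := hg2 hQg'
          push_cast
          linarith
        · rw [if_neg hQg']
          push_cast
          linarith
  have := abs_sub_abs_le_abs_sub (pair gs.sum y) (pair (gs.filter fun g => μ g ≤ Q).sum y)
  linarith

/-- A bound for functionals of small index is upgraded to all indices by averaging successive
vectors, each chosen for a cutoff beyond which the functionals nearly vanish on the previous ones.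
The intermediate indices cost at most `n₀` in total, which a long average absorbs. -/
theorem exists_average_of_small_index {G : ℕ → Set C00} {n₀ : ℕ} {α ε : ℝ} (hε : 0 < ε)
    (hsup : ∀ x i, |x i| ≤ N x) (hball : ∀ m, G m ⊆ dualBall N)
    (hdecay : ∀ y : C00, ∀ δ : ℝ, 0 < δ → ∃ Q, ∀ m, Q < m → ∀ g ∈ G m, |pair g y| ≤ δ)
    (hsmall : ∀ Q q, ∃ y, (ψ y = t ∧ N y ≤ 1 ∧ ∀ i ∈ y.support, q ≤ i) ∧
      ∀ gs : List C00, gs.length ≤ n₀ → gs.Pairwise Precedes →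
        (∀ g ∈ gs, ∃ m, m ≤ Q ∧ g ∈ G m) → |pair gs.sum y| ≤ α) (q : ℕ) :
    ∃ w, (ψ w = t ∧ N w ≤ 1 ∧ ∀ i ∈ w.support, q ≤ i) ∧ (∀ i, |w i| ≤ ε) ∧
      ∀ gs : List C00, gs.length ≤ n₀ → gs.Pairwise Precedes →
        (∀ g ∈ gs, ∃ m, g ∈ G m) → |pair gs.sum w| ≤ α + 2 * ε := by
  -- A functional may belong to several `G m`; one index is fixed for each. The default `0` is never
  -- consulted.
  obtain ⟨μ, hμ⟩ : ∃ μ : C00 → ℕ, ∀ g, (∃ m, g ∈ G m) → g ∈ G (μ g) := by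
    classical
    refine ⟨fun g => if h : ∃ m, g ∈ G m then h.choose else 0, fun g h => ?_⟩
    simp only [h, dite_true]
    exact h.choose_spec
  have key : ∀ L Q q : ℕ, ∃ ys : List C00, ys.length = L ∧ ys.Pairwise Precedes ∧
      (∀ y ∈ ys, ψ y = t ∧ N y ≤ 1 ∧ ∀ i ∈ y.support, q ≤ i) ∧
      ∀ gs : List C00, gs.length ≤ n₀ → gs.Pairwise Precedes → (∀ g ∈ gs, ∃ m, g ∈ G m) →
        |pair gs.sum ys.sum| ≤ (α + ε) * L + gs.countP (fun g => Q < μ g) := by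
    intro L
    induction L with
    | zero => exact fun Q q => ⟨[], rfl, .nil, by simp, by simp⟩
    | succ L ih =>
      intro Q q
      obtain ⟨y, hy, hyα⟩ := hsmall Q q
      obtain ⟨p, hp⟩ := exists_support_lt y
      obtain ⟨Q₁, hQ₁⟩ := hdecay y (ε / (n₀ + 1)) (by positivity)
      obtain ⟨ys, hlen, hpw, hys, hysg⟩ := ih (max Q Q₁) (max p q)
      refine ⟨y :: ys, by simp [hlen], List.pairwise_cons.2 ⟨fun z hz =>
        precedes_of_support_lt hp fun i hi => le_of_max_le_left ((hys z hz).2.2 i hi), hpw⟩,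
        fun z hz => ?_, fun gs hgs hgpw hgG => ?_⟩
      · rcases List.mem_cons.1 hz with rfl | hz
        · exact hy
        · exact ⟨(hys z hz).1, (hys z hz).2.1,
            fun i hi => le_of_max_le_right ((hys z hz).2.2 i hi)⟩
      · have h1 := hysg gs hgs hgpw hgG
        have h2 := abs_pair_list_sum_le (μ := μ) (y := y) (le_max_left Q Q₁)
          (δ := ε / (n₀ + 1)) (by positivity) (gs := gs)
          (fun g hg => (hball _ (hμ g (hgG g hg)) y).trans hy.2.1)
          (fun g hg hQg => hQ₁ _ (lt_of_le_of_lt (le_max_right _ _) hQg) g (hμ g (hgG g hg)))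
        have h3 := hyα (gs.filter fun g => μ g ≤ Q) ((List.length_filter_le _ _).trans hgs)
          (hgpw.sublist List.filter_sublist) (fun g hg => by
            obtain ⟨hg, hgQ⟩ := List.mem_filter.1 hg
            exact ⟨μ g, by simpa using hgQ, hμ g (hgG g hg)⟩)
        have h4 : ε / (n₀ + 1) * gs.length ≤ ε := by
          rw [div_mul_eq_mul_div, div_le_iff₀ (by positivity)]
          have : (gs.length : ℝ) ≤ n₀ := by exact_mod_cast hgs
          exact mul_le_mul_of_nonneg_left (by linarith) hε.le
        have h5 := abs_add_le (pair gs.sum y) (pair gs.sum ys.sum)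
        rw [List.sum_cons, pair_add_right]
        push_cast at h1 ⊢
        linarith
  -- This length gives both `n₀ ≤ ε * L` for the intermediate indices and `1 / L ≤ ε` for the
  -- coordinates.
  obtain ⟨L, hL⟩ := exists_nat_gt (((n₀ : ℝ) + 1) / ε)
  have hL0 : (0 : ℝ) < L := lt_trans (by positivity) hL
  rw [div_lt_iff₀ hε] at hL
  obtain ⟨ys, hlen, hpw, hys, hysg⟩ := key L 0 q
  have hne : ys ≠ [] := by
    rintro rfl
    simp [← hlen] at hL0
  have hav := average_spec hne hys
  rw [hlen] at hav
  have hn₀ : (0 : ℝ) ≤ n₀ := Nat.cast_nonneg _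
  refine ⟨_, hav, fun i => ?_, fun gs hgs hgpw hgG => ?_⟩
  · have := abs_sum_apply_le hpw zero_le_one
      (fun y hy i => (hsup y i).trans (hys y hy).2.1) i
    rw [Finsupp.smul_apply, smul_eq_mul, abs_mul, abs_of_pos (by positivity),
      one_div_mul_eq_div, div_le_iff₀ hL0]
    nlinarith
  · rw [pair_smul_right, abs_mul, abs_of_pos (by positivity), one_div_mul_eq_div, div_le_iff₀ hL0]
    have h1 := hysg gs hgs hgpw hgG
    have h2 : (gs.countP (fun g => 0 < μ g) : ℝ) ≤ n₀ := by
      exact_mod_cast List.countP_le_length.trans hgs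
    nlinarith

end Spread

/-! ### Bounded functionals vanish at infinity -/

namespace IsSolution

variable {H : Set C00} {M : ℕ → ℕ} {σ : List C00 → ℕ} {N : Seminorm ℝ C00}
  {ψ : C00 →ₗ[ℝ] ℝ} {t : ℝ}

lemma exists_forall_abs_pair_le_of_lt {G : ℕ → Set C00}
    (hG : ∀ m, ∀ g ∈ G m, 1 ≤ m ∧ ∀ i, |g i| ≤ 1 / f m) (y : C00) {δ : ℝ} (hδ : 0 < δ) :
    ∃ Q, ∀ m, Q < m → ∀ g ∈ G m, |pair g y| ≤ δ := by
  obtain ⟨Q, hQ⟩ := Filter.eventually_atTop.1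
    (tendsto_f.eventually_ge_atTop (oneNorm y / δ))
  refine ⟨Q, fun m hm g hg => ?_⟩
  obtain ⟨hm1, hgi⟩ := hG m g hg
  refine (abs_pair_le_mul_oneNorm_right hgi).trans ?_
  have := hQ m hm.le
  rw [div_le_iff₀ hδ] at this
  rw [one_div_mul_eq_div, div_le_iff₀ (f_pos hm1)]
  linarith

/-- Vectors on which short sums of members of the second layer are small. -/
lemma exists_forall_setB_le (hN : IsSolution H M σ N) (hH : IsBaseSet H) (hM : IsIndexSeq M)
    (hs : Spread N ψ t) (n₀ q : ℕ) :
    ∃ w, (ψ w = t ∧ N w ≤ 1 ∧ ∀ i ∈ w.support, q ≤ i) ∧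
      ∀ gs : List C00, gs.length ≤ n₀ → gs.Pairwise Precedes →
        (∀ g ∈ gs, ∃ m, g ∈ setB H M σ N m) → |pair gs.sum w| ≤ 3 / 4 := by
  obtain ⟨w, h1, -, h2⟩ := exists_average_of_small_index (ψ := ψ) (t := t) (n₀ := n₀)
    (α := 5 / 8) (ε := 1 / 16) (by norm_num) hN.abs_apply_le (hN.setB_subset hH hM)
    (fun y δ hδ => exists_forall_abs_pair_le_of_lt (fun m g hg => ⟨one_le_two.trans hg.1,
      abs_le_of_mem_gam hH (longAvgSet_subset (W := dualBall N) hH)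
        (one_le_two.trans hg.1) hg.2⟩) y hδ)
    (fun Q q => by
      -- The block estimate is `L / 2 + (2 * Q + 1 / 2) * n₀`; the second term is kept below `L /
      -- 8`, whence `5 / 8`.
      obtain ⟨L, hL⟩ := exists_nat_gt (8 * ((2 * Q + 1 / 2) * n₀ : ℝ))
      have hL0 : (0 : ℝ) < L := lt_of_le_of_lt (by positivity) hL
      obtain ⟨ys, hlen, hpw, hys⟩ := hs.exists_list L q
      have hne : ys ≠ [] := by
        rintro rfl
        simp [← hlen] at hL0
      have hav := average_spec hne hys
      rw [hlen] at hav
      refine ⟨_, hav, fun gs hgs hgpw hgG => ?_⟩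
      have hb := BlockBound.list_sum (N := N) hgpw (τ := 1 / 2) (κ := 2 * Q) (by norm_num)
        (fun g hg => by
          obtain ⟨m, hm, hgm⟩ := hgG g hg
          have : (m : ℝ) ≤ Q := by exact_mod_cast hm
          exact (blockBound_of_mem_setB hgm).mono le_rfl (by linarith)) ys hpw
        fun y hy => (hys y hy).2.1
      rw [hlen] at hb
      have hgs' : (gs.length : ℝ) ≤ n₀ := by exact_mod_cast hgs
      have := mul_le_mul_of_nonneg_left hgs' (show (0 : ℝ) ≤ 2 * Q + 1 / 2 by positivity)
      rw [pair_smul_right, abs_mul, abs_of_pos (by positivity), one_div_mul_eq_div,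
        div_le_iff₀ hL0]
      linarith) q
  exact ⟨w, h1, fun gs ha hb hc => (h2 gs ha hb hc).trans (by norm_num)⟩

/-- The gliding hump is applied once more, now to single third-layer functionals; it loses another
`1 / 8` and turns `3 / 4` into `7 / 8`. -/
lemma exists_norm_le (hN : IsSolution H M σ N) (hH : IsBaseSet H) (hM : IsIndexSeq M)
    (hs : Spread N ψ t) (q : ℕ) : ∃ w, ψ w = t ∧ N w ≤ 7 / 8 ∧ ∀ i ∈ w.support, q ≤ i := by
  obtain ⟨w, ⟨h1, -, h1'⟩, hsup, h2⟩ := exists_average_of_small_index (ψ := ψ) (t := t) (n₀ := 1)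
    (G := fun n => {a | 1 ≤ n ∧ a ∈ Gam (setB H M σ N) M σ n})
    (α := 3 / 4) (ε := 1 / 16) (by norm_num) hN.abs_apply_le
    (fun n a ha => hN.setC_subset ⟨n, ha⟩)
    (fun y δ hδ => exists_forall_abs_pair_le_of_lt (fun m g hg => ⟨hg.1,
      abs_le_of_mem_gam hH (innerSet_subset (W := dualBall N) hH) hg.1 hg.2⟩) y hδ)
    (fun Q q => by
      -- A third-layer functional of index at most `Q` involves at most `Q` second-layer ones, so
      -- the cutoff serves as the length bound `n₀`.
      obtain ⟨w, hw, hwg⟩ := hN.exists_forall_setB_le hH hM hs Q q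
      refine ⟨w, hw, fun gs hgs _ hgG => ?_⟩
      match gs, hgs with
      | [], _ => norm_num
      | [g], _ =>
        obtain ⟨m, hmQ, hm, hg⟩ := hgG g (by simp)
        obtain ⟨l, hl, hlen, rfl⟩ := (mem_gam_iff hm).1 hg
        have hf := one_div_f_le_one hm
        have hf0 : 0 ≤ 1 / f m := by have := f_pos hm; positivity
        have := hwg l (hlen.trans_le hmQ) hl.isBlock.2 fun b hb => by
          rcases hl.exists_mem hb with ⟨i, _, h⟩ | ⟨_, _, _, h⟩
          exacts [⟨_, h⟩, ⟨_, h⟩]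
        simp only [List.sum_cons, List.sum_nil, add_zero]
        rw [pair_smul_left, abs_mul, abs_of_nonneg hf0]
        exact (mul_le_of_le_one_left (abs_nonneg _) hf).trans this
      | _ :: _ :: _, h => simp at h) q
  refine ⟨w, h1, (hN.le_iff _ _).2 ⟨fun i => (hsup i).trans (by norm_num), fun a ha => ?_⟩, h1'⟩
  have := h2 [a] (by simp) (by simp) (by simpa using! ha)
  simp only [List.sum_cons, List.sum_nil, add_zero] at this
  linarith

lemma spread_mul (hN : IsSolution H M σ N) (hH : IsBaseSet H) (hM : IsIndexSeq M)
    (hs : Spread N ψ t) : Spread N ψ (8 / 7 * t) := by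
  intro q
  obtain ⟨w, h1, h2, h3⟩ := hN.exists_norm_le hH hM hs q
  refine ⟨(8 / 7 : ℝ) • w, by simp [h1], ?_, fun i hi => h3 i (Finsupp.support_smul hi)⟩
  rw [map_smul_eq_mul, Real.norm_of_nonneg (by norm_num)]
  linarith

theorem not_spread (hN : IsSolution H M σ N) (hH : IsBaseSet H) (hM : IsIndexSeq M)
    {K : ℝ} (hψ : ∀ x, ψ x ≤ K * N x) (hK : 0 ≤ K) (ht : 0 < t) : ¬ Spread N ψ t := by
  intro hs
  have h : ∀ r : ℕ, Spread N ψ ((8 / 7) ^ r * t) := fun r => by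
    induction r with
    | zero => simpa using hs
    | succ r ih =>
      have := hN.spread_mul hH hM ih
      rwa [← mul_assoc, ← pow_succ'] at this
  obtain ⟨r, hr⟩ := pow_unbounded_of_one_lt (K / t) (show (1 : ℝ) < 8 / 7 by norm_num)
  obtain ⟨x, hx, hNx, -⟩ := h r 0
  rw [div_lt_iff₀ ht, ← hx] at hr
  have := (hψ x).trans (mul_le_of_le_one_right hK hNx)
  linarith

end IsSolution

/-! ### The basis is shrinking -/

lemma exists_support_ge_of_mem_span {N : Seminorm ℝ C00} {q : ℕ} {z : CompletionOf N}
    (hz : z ∈ Submodule.span ℝ ((fun i => toCompl N (unitVec i)) '' Set.Ici q)) :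
    ∃ y : C00, (∀ i ∈ y.support, q ≤ i) ∧ toCompl N y = z := by
  have h : Submodule.span ℝ ((fun i => toCompl N (unitVec i)) '' Set.Ici q) ≤
      (Finsupp.supported ℝ ℝ (Set.Ici q)).map (toComplₗ N) := by
    rw [Submodule.span_le]
    rintro _ ⟨i, hi, rfl⟩
    exact ⟨unitVec i, Finsupp.single_mem_supported ℝ 1 hi, rfl⟩
  obtain ⟨y, hy, rfl⟩ := h hz
  exact ⟨y, fun i hi => (Finsupp.mem_supported ℝ y).1 hy hi, rfl⟩

namespace IsSolution

variable {H : Set C00} {M : ℕ → ℕ} {σ : List C00 → ℕ} {N : Seminorm ℝ C00}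

theorem isShrinking (hN : IsSolution H M σ N) (hH : IsBaseSet H) (hM : IsIndexSeq M) :
    IsShrinking fun i => toCompl N (unitVec i) := by
  intro φ ε hε
  by_contra! hφ
  set ψ : C00 →ₗ[ℝ] ℝ := φ.toLinearMap ∘ₗ toComplₗ N with hψ
  have hψφ : ∀ x, ψ x = φ (toCompl N x) := fun _ => rfl
  have hle : ∀ x, |ψ x| ≤ ‖φ‖ * N x := fun x => by
    rw [hψφ, ← norm_toCompl]
    exact φ.le_opNorm _
  refine hN.not_spread hH hM (fun x => (le_abs_self _).trans (hle x)) (norm_nonneg φ) hε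
    fun q => ?_
  obtain ⟨y, hyq, hy⟩ : ∃ y : C00, (∀ i ∈ y.support, q ≤ i) ∧ ε * N y < |ψ y| := by
    by_contra! h
    obtain ⟨z, hz, hzε⟩ := hφ q
    refine hzε.not_ge ?_
    have hcl : IsClosed {z : CompletionOf N | |φ z| ≤ ε * ‖z‖} :=
      isClosed_le φ.continuous.abs (continuous_const.mul continuous_norm)
    refine closure_minimal (fun z hz => ?_) hcl hz
    obtain ⟨y, hyq, rfl⟩ := exists_support_ge_of_mem_span hz
    rw [Set.mem_ofPred_eq, norm_toCompl]
    exact h y hyq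
  have h0 : 0 < |ψ y| := lt_of_le_of_lt (mul_nonneg hε.le (apply_nonneg N y)) hy
  -- This multiple normalizes the value of `ψ` to `ε`, and `ε * N y < |ψ y|` keeps the norm below
  -- one.
  refine ⟨(ε / ψ y) • y, ?_, ?_, fun i hi => hyq i (Finsupp.support_smul hi)⟩
  · rw [map_smul, smul_eq_mul, div_mul_cancel₀ _ (abs_pos.1 h0)]
  · rw [map_smul_eq_mul, Real.norm_eq_abs, abs_div, abs_of_pos hε, div_mul_eq_mul_div,
      div_le_one h0]
    exact hy.le

/-! ### The basis is boundedly complete -/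

lemma oneNorm_restrict_le (I : Set ℕ) (x : C00) : oneNorm (restrict I x) ≤ oneNorm x := by
  rw [oneNorm_eq_sum, oneNorm_eq_sum]
  have hsub : (restrict I x).support ⊆ x.support := fun i hi => by
    rw [Finsupp.mem_support_iff] at hi ⊢
    intro h0
    exact hi (abs_nonpos_iff.1 ((abs_restrict_apply_le I x i).trans (by simp [h0])))
  exact (Finset.sum_le_sum fun i _ => abs_restrict_apply_le I x i).trans
    (Finset.sum_le_sum_of_subset_of_nonneg hsub fun _ _ _ => abs_nonneg _)

lemma restrict_Ico_eq_sub {p n : ℕ} (hpn : p ≤ n) (x : C00) :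
    restrict (Set.Ico p n) x = restrict (Set.Iio n) x - restrict (Set.Iio p) x := by
  ext i
  rw [Finsupp.sub_apply]
  by_cases h1 : i < n
  · rw [restrict_apply_of_mem (I := Set.Iio n) h1]
    by_cases h2 : i < p
    · rw [restrict_apply_of_mem (I := Set.Iio p) h2,
        restrict_apply_of_notMem (fun h => h.1.not_gt h2), sub_self]
    · rw [restrict_apply_of_notMem (I := Set.Iio p) (by simpa using h2),
        restrict_apply_of_mem (Set.mem_Ico.2 ⟨not_lt.1 h2, h1⟩), sub_zero]
  · rw [restrict_apply_of_notMem (I := Set.Iio n) (by simpa using h1),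
      restrict_apply_of_notMem (I := Set.Iio p) (by simp; omega),
      restrict_apply_of_notMem (fun h => h1 h.2), sub_zero]

lemma restrict_Ico_le (hN : IsSolution H M σ N) {p n : ℕ} (hpn : p ≤ n) (x : C00) :
    N (restrict (Set.Ico p n) x) ≤ 2 * N x := by
  rw [restrict_Ico_eq_sub hpn]
  refine (map_sub_le_add N _ _).trans ?_
  linarith [hN.restrict_le n x, hN.restrict_le p x]

lemma exists_mem_dualBall_lt_pair (hN : IsSolution H M σ N) {x : C00} {r : ℝ} (h : r < N x) :
    ∃ g ∈ dualBall N, r < pair g x := by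
  obtain ⟨g, hg, hgx⟩ : ∃ g ∈ dualBall N, r < |pair g x| := by
    by_contra! h'
    refine h.not_ge ((hN.le_iff x r).2 ⟨fun i => ?_, fun a ha => h' a (hN.setC_subset ha)⟩)
    simpa [pair_single_left] using h' (Finsupp.single i 1) fun y => by
      simpa [pair_single_left] using hN.abs_apply_le y i
  rcases abs_choice (pair g x) with h' | h'
  · exact ⟨g, hg, h' ▸ hgx⟩
  · refine ⟨-g, fun y => ?_, by rw [pair_neg_left]; exact h' ▸ hgx⟩
    rw [pair_neg_left, abs_neg]
    exact hg y

/-- Vectors supported in an interval are almost normed by members of `H` in the dual ball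
supported there, up to a constant. -/
lemma exists_mem_lt_pair (hN : IsSolution H M σ N) (hH : IsBaseSet H) {x : C00} {p n : ℕ}
    (hpn : p ≤ n) (hx : ∀ i ∈ x.support, i ∈ Set.Ico p n) {ε K : ℝ} (hε : 0 < ε)
    (hK : ∀ i, |x i| ≤ K) (hεx : ε ≤ N x) :
    ∃ h ∈ H ∩ dualBall N, (∀ i ∈ h.support, i ∈ Set.Ico p n) ∧ ε / 16 ≤ pair h x := by
  obtain ⟨g, hg, hgx⟩ := hN.exists_mem_dualBall_lt_pair (x := x) (r := ε / 2) (by linarith)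
  have hK0 : 0 ≤ K := (abs_nonneg _).trans (hK 0)
  -- Restricting to an interval at most doubles the dual norm, so the factor `1 / 4` leaves dual
  -- norm at most `1 / 2`. The remaining `1 / 2` absorbs the approximation by `H`.
  set u : C00 := (1 / 4 : ℝ) • restrict (Set.Ico p n) g with hu
  have hux : ε / 8 ≤ pair u x := by
    rw [hu, pair_smul_left, pair_restrict, restrict_eq_self hx]
    linarith
  have hub : ∀ z, |pair u z| ≤ 1 / 2 * N z := fun z => by
    rw [hu, pair_smul_left, pair_restrict, abs_mul, abs_of_pos (by norm_num)]
    have h1 := hg (restrict (Set.Ico p n) z)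
    have h2 := hN.restrict_Ico_le hpn z
    linarith
  obtain ⟨h₀, hh₀, hη⟩ := hH.dense u (fun i => by
    have := hub (unitVec i)
    rw [pair_unitVec_right, hN.apply_unitVec hH] at this
    linarith) (min (1 / 2) (ε / (16 * (K + 1)))) (by positivity)
  set h := restrict (Set.Ico p n) h₀ with hh
  have huh : oneNorm (u - h) ≤ min (1 / 2) (ε / (16 * (K + 1))) := by
    have h1 : u - h = restrict (Set.Ico p n) (u - h₀) := by
      rw [sub_eq_add_neg, sub_eq_add_neg, ← neg_one_smul ℝ h, ← neg_one_smul ℝ h₀, restrict_add,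
        restrict_smul, hu, restrict_smul, restrict_restrict, Set.inter_self]
    rw [h1]
    exact (oneNorm_restrict_le _ _).trans hη.le
  have hsub : ∀ z, pair h z = pair u z - pair (u - h) z := fun z => by
    rw [pair_sub_left]
    ring
  have hhx : ε / 16 ≤ pair h x := by
    have h1 := (abs_pair_le_mul_oneNorm_left (a := u - h) hK).trans
      (mul_le_mul_of_nonneg_left (huh.trans (min_le_right _ _)) hK0)
    have h2 : K * (ε / (16 * (K + 1))) ≤ ε / 16 := by
      rw [mul_div_assoc', div_le_div_iff₀ (by positivity) (by norm_num)]
      nlinarith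
    have h3 := le_abs_self (pair (u - h) x)
    rw [hsub]
    linarith
  refine ⟨h, ⟨hH.restrict_mem h₀ hh₀ _ Set.ordConnected_Ico fun h0 => ?_, fun z => ?_⟩,
    fun i hi => ?_, hhx⟩
  · rw [hh, h0, pair_zero_left] at hhx
    linarith
  · have h1 := (abs_pair_le_mul_oneNorm_left (a := u - h) (hN.abs_apply_le z)).trans
      (mul_le_mul_of_nonneg_left (huh.trans (min_le_left _ _)) (apply_nonneg N z))
    have h2 := abs_sub (pair u z) (pair (u - h) z)
    rw [hsub]
    linarith [hub z]
  · by_contra hi'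
    exact Finsupp.mem_support_iff.1 hi (restrict_apply_of_notMem hi' h₀)

lemma length_mul_le_apply_sum {A : C00 →ₗ[ℝ] ℝ} {δ : ℝ} {l : List C00} (h : ∀ a ∈ l, δ ≤ A a) :
    l.length * δ ≤ A l.sum := by
  induction l with
  | nil => simp
  | cons a l ih =>
    have h1 := ih fun b hb => h b (by simp [hb])
    have h2 := h a (by simp)
    rw [List.sum_cons, map_add, List.length_cons]
    push_cast
    linarith

/-- If `A` is bounded below on far members of `H` in the dual ball, then it is large on the second
layer. -/
lemma exists_mem_setB_le_apply {A : C00 →ₗ[ℝ] ℝ} {δ : ℝ} (hδ : 0 < δ)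
    (h : ∀ p, ∃ g ∈ H ∩ dualBall N, (∀ i ∈ g.support, p ≤ i) ∧ δ ≤ A g) {m : ℕ} (hm : 2 ≤ m) :
    ∃ b ∈ setB H M σ N m, m / f m * δ ≤ A b := by
  have hne : ∀ {g}, δ ≤ A g → g ≠ 0 := by
    rintro g hg rfl
    rw [map_zero] at hg
    linarith
  -- Averages keep the lower bound `δ`, and they exist arbitrarily far out at every index, so
  -- whatever code is prescribed can be met.
  have h1 : ∀ k p, ∃ g ∈ setAt H N k, (∀ i ∈ g.support, p ≤ i) ∧ δ ≤ A g := fun k p => by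
    obtain ⟨l, hl, hlen, hlp, hlδ⟩ := exists_adm (D := fun _ => H ∩ dualBall N) (σ := fun _ => 0)
      (K := 0) (Q := fun g => δ ≤ A g) (fun l _ p => by
        obtain ⟨g, hg, hgp, hgδ⟩ := h p
        refine ⟨g, ?_, hne hgδ, hgp, hgδ⟩
        rcases eq_or_ne l [] with h' | h'
        · exact .inl ⟨h', 0, le_rfl, hg⟩
        · exact .inr ⟨h', hg⟩) (max 2 k) p
    obtain ⟨hl1, hl2⟩ := adm_const_iff.1 hl
    have hpos : (0 : ℝ) < (max 2 k : ℕ) := by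
      exact_mod_cast lt_of_lt_of_le two_pos (le_max_left 2 k)
    refine ⟨_, ⟨max 2 k, le_max_left _ _, le_max_right _ _, l, hl1, hl2, hlen, rfl⟩,
      fun i hi => support_list_sum_ge hlp i (Finsupp.support_smul hi), ?_⟩
    have := length_mul_le_apply_sum hlδ
    rw [hlen] at this
    rw [map_smul, smul_eq_mul, one_div_mul_eq_div, le_div_iff₀ hpos]
    linarith
  obtain ⟨l, hl, hlen, -, hlδ⟩ := exists_adm (D := setAt H N) (σ := σ)
    (K := M m) (Q := fun g => δ ≤ A g) (fun l _ p => by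
      rcases eq_or_ne l [] with h' | h'
      · obtain ⟨g, hg, hgp, hgδ⟩ := h1 (M m) p
        exact ⟨g, .inl ⟨h', _, le_rfl, hg⟩, hne hgδ, hgp, hgδ⟩
      · obtain ⟨g, hg, hgp, hgδ⟩ := h1 (σ l) p
        exact ⟨g, .inr ⟨h', hg⟩, hne hgδ, hgp, hgδ⟩) m 0
  refine ⟨_, ⟨hm, (mem_gam_iff (one_le_two.trans hm)).2 ⟨l, hl, hlen, rfl⟩⟩, ?_⟩
  have := length_mul_le_apply_sum hlδ
  rw [hlen] at this
  have hf := f_pos (one_le_two.trans hm)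
  rw [map_smul, smul_eq_mul, one_div_mul_eq_div, div_mul_eq_mul_div]
  gcongr

lemma sum_smul_unitVec_apply (a : ℕ → ℝ) (n i : ℕ) :
    (∑ j ∈ Finset.range n, a j • unitVec j) i = if i < n then a i else 0 := by
  rw [Finsupp.finsetSum_apply]
  split_ifs with h
  · rw [Finset.sum_eq_single i]
    · simp [unitVec]
    · intro j _ hj
      simp [unitVec, hj]
    · simp [h]
  · refine Finset.sum_eq_zero fun j hj => ?_
    have : j ≠ i := by rintro rfl; exact h (Finset.mem_range.1 hj)
    simp [unitVec, this]

theorem isBoundedlyComplete (hN : IsSolution H M σ N) (hH : IsBaseSet H) (hM : IsIndexSeq M) :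
    IsBoundedlyComplete fun i => toCompl N (unitVec i) := by
  rintro a ⟨K, hK⟩
  set S : ℕ → C00 := fun n => ∑ j ∈ Finset.range n, a j • unitVec j with hS
  have hSa : ∀ n i, S n i = if i < n then a i else 0 := sum_smul_unitVec_apply a
  simp only [← toCompl_sum_smul] at hK ⊢
  change ∀ n, ‖toCompl N (S n)‖ ≤ K at hK
  change ∃ x, Filter.Tendsto (fun n => toCompl N (S n)) Filter.atTop (nhds x)
  simp only [norm_toCompl] at hK
  have haK : ∀ i, |a i| ≤ K := fun i => by
    have := (hN.abs_apply_le (S (i + 1)) i).trans (hK _)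
    rwa [hSa, if_pos (Nat.lt_succ_self i)] at this
  have hK0 : 0 ≤ K := (abs_nonneg _).trans (haK 0)
  refine cauchySeq_tendsto_of_complete ?_
  by_contra hC
  rw [Metric.cauchySeq_iff'] at hC
  push Not at hC
  obtain ⟨ε, hε, hC⟩ := hC
  -- `A` is evaluation at the formal series: on a finitely supported functional it agrees with every
  -- sufficiently long partial sum.
  set A : C00 →ₗ[ℝ] ℝ := Finsupp.linearCombination ℝ a with hA
  have hApair : ∀ g x : C00, (∀ i ∈ g.support, x i = a i) → A g = pair g x := fun g x h => by
    rw [hA, Finsupp.linearCombination_apply, pair_eq_sum_left subset_rfl]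
    exact Finset.sum_congr rfl fun i hi => by rw [h i hi]; rfl
  have hfar : ∀ p, ∃ g ∈ H ∩ dualBall N, (∀ i ∈ g.support, p ≤ i) ∧ ε / 16 ≤ A g := fun p => by
    obtain ⟨n, hpn, hn⟩ := hC p
    have hxa : ∀ i, (S n - S p) i = if i ∈ Set.Ico p n then a i else 0 := fun i => by
      rw [Finsupp.sub_apply, hSa, hSa]
      simp only [Set.mem_Ico]
      split_ifs <;> first | omega | simp
    obtain ⟨g, hg, hgs, hgx⟩ := hN.exists_mem_lt_pair hH hpn (x := S n - S p)
      (fun i hi => by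
        by_contra h
        rw [Finsupp.mem_support_iff, hxa, if_neg h] at hi
        exact hi rfl) hε
      (fun i => by rw [hxa]; split_ifs; exacts [haK i, by simpa])
      (by rw [dist_eq_norm, ← toComplₗ_apply, ← toComplₗ_apply, ← map_sub, toComplₗ_apply,
            norm_toCompl] at hn; exact hn)
    refine ⟨g, hg, fun i hi => (hgs i hi).1, ?_⟩
    rwa [hApair g _ fun i hi => by rw [hxa, if_pos (hgs i hi)]]
  obtain ⟨m, hm, hmK⟩ := exists_lt_div_f (K / (ε / 16))
  obtain ⟨b, hb, hbA⟩ := exists_mem_setB_le_apply (M := M) (σ := σ) (by positivity) hfar hm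
  obtain ⟨n, hn⟩ := exists_support_lt b
  rw [div_lt_iff₀ (by positivity)] at hmK
  rw [hApair b (S n) fun i hi => by rw [hSa, if_pos (hn i hi)]] at hbA
  have h1 := (le_abs_self _).trans (hN.setB_subset hH hM m hb (S n))
  linarith [hK n]

end IsSolution

/-! ### Reflexivity -/

/-- A Banach space with a monotone basis that is shrinking and boundedly complete is reflexive. -/
theorem isReflexive_of_isShrinking_of_isBoundedlyComplete {E : Type*} [NormedAddCommGroup E]
    [NormedSpace ℝ E] (b : SchauderBasis ℝ E) (hproj : ∀ n, ‖b.proj n‖ ≤ 1)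
    (hs : IsShrinking b) (hb : IsBoundedlyComplete b) : IsReflexive E := by
  intro ξ
  set S : ℕ → E := fun n => ∑ i ∈ Finset.range n, ξ (b.coord i) • b i with hS
  -- This identity yields both steps of the argument: contractive projections bound `S`, and
  -- shrinking makes `φ ∘L b.proj n` converge to `φ` in norm.
  have hφS : ∀ (φ : StrongDual ℝ E) n, φ (S n) = ξ (φ ∘L b.proj n) := by
    intro φ n
    have : φ ∘L b.proj n = ∑ i ∈ Finset.range n, φ (b i) • b.coord i := by
      ext z
      simp [mul_comm]
    rw [this]
    simp [hS, mul_comm]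
  have hbound : ∀ n, ‖S n‖ ≤ ‖ξ‖ := by
    intro n
    refine NormedSpace.norm_le_dual_bound ℝ _ (ContinuousLinearMap.opNorm_nonneg ξ) fun φ => ?_
    rw [hφS]
    refine (ξ.le_opNorm _).trans
      (mul_le_mul_of_nonneg_left ?_ (ContinuousLinearMap.opNorm_nonneg ξ))
    exact (φ.opNorm_comp_le _).trans (mul_le_of_le_one_right (norm_nonneg _) (hproj n))
  obtain ⟨x, hx⟩ := hb _ ⟨_, hbound⟩
  refine ⟨x, ContinuousLinearMap.ext fun φ => ?_⟩
  rw [NormedSpace.dual_def]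
  have h1 : Filter.Tendsto (fun n => φ (S n)) Filter.atTop (nhds (φ x)) :=
    (φ.continuous.tendsto x).comp hx
  refine tendsto_nhds_unique h1 ?_
  simp only [hφS]
  refine (ξ.continuous.tendsto φ).comp ?_
  rw [Metric.tendsto_atTop]
  intro ε hε
  obtain ⟨n, hn⟩ := hs φ (ε / 4) (by positivity)
  refine ⟨n, fun k hk => ?_⟩
  rw [dist_eq_norm, ← norm_neg, neg_sub]
  refine lt_of_le_of_lt (ContinuousLinearMap.opNorm_le_bound _ (show 0 ≤ ε / 2 by positivity)
    fun z => ?_) (half_lt_self hε)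
  -- The remainder is the limit of `b.proj m z - b.proj k z`, each of which lies in the span of the
  -- tail.
  have hmem : z - b.proj k z ∈ (Submodule.span ℝ (b '' Set.Ici n)).topologicalClosure := by
    refine mem_closure_of_tendsto ((SchauderBasis.tendsto_proj b z).sub_const (b.proj k z)) ?_
    filter_upwards [Filter.eventually_ge_atTop k] with m hm
    rw [SchauderBasis.proj_apply, SchauderBasis.proj_apply, ← Finset.sum_Ico_eq_sub _ hm]
    exact Submodule.sum_mem _ fun i hi => Submodule.smul_mem _ _
      (Submodule.subset_span ⟨i, hk.trans (Finset.mem_Ico.1 hi).1, rfl⟩)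
  have h2 := hn _ hmem
  have h3 : ‖z - b.proj k z‖ ≤ 2 * ‖z‖ := by
    have := (b.proj k).le_of_opNorm_le (hproj k) z
    linarith [norm_sub_le z (b.proj k z)]
  calc ‖(φ - φ ∘L b.proj k) z‖ = |φ (z - b.proj k z)| := by
        rw [map_sub]
        rfl
    _ ≤ ε / 4 * ‖z - b.proj k z‖ := h2
    _ ≤ ε / 4 * (2 * ‖z‖) := by gcongr
    _ = ε / 2 * ‖z‖ := by ring

end OdellSchlumprecht

open OdellSchlumprecht in
theorem proposition3p1 (H : Set C00) (hH : IsBaseSet H)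
    (M : ℕ → ℕ) (hM : IsIndexSeq M)
    (σ : List C00 → ℕ) (hσ : IsCoding H σ) :
    ∃ N : Seminorm ℝ C00, ClassN N ∧
      (∀ x : C00, BddAbove (absValues (setC H M σ N) x) ∧
        N x = max (supNorm x) (sSup (absValues (setC H M σ N) x))) ∧
      IsReflexive (CompletionOf N) ∧
      IsShrinking (fun i => toCompl N (unitVec i)) ∧
      IsBoundedlyComplete (fun i => toCompl N (unitVec i)) := by
  obtain ⟨N, hN⟩ := exists_isSolution (M := M) hH hσ
  have hclass : ClassN N :=
    classN_of_forall hN.abs_apply_le hN.restrict_le (hN.apply_unitVec hH)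
  have hs := hN.isShrinking hH hM
  have hb := hN.isBoundedlyComplete hH hM
  refine ⟨N, hclass, fun x => ⟨bddAbove_absValues (fun a ha i =>
    IsSolution.abs_le_one_of_mem_setC hH ha i) x, hN.apply_eq x⟩, ?_, hs, hb⟩
  obtain ⟨-, b, hbe, -, hproj, -⟩ := hclass
  rw [← (funext hbe : ⇑b = fun i => toCompl N (unitVec i))] at hs hb
  exact isReflexive_of_isShrinking_of_isBoundedlyComplete b hproj hs hb
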